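/- Let $n,k,l$ be integers with $k\ge 2$ and $0\le l<k<n$, and let $M,N\ge 0$. There is a constant $C>0$, depending only on $n,k,l,M,N$, with the following property. Let $\Omega\subset\mathbb R^n$ be a bounded domain, let $\psi=\psi(x,z,\nu)\ge 0$ be a function on $\overline\Omega\times\mathbb R\times\mathbb S^n$ such that $\psi^{1/(k-l)}\in C^{1,1}(\overline\Omega\times\mathbb R\times\mathbb S^n)$, in the sense that its $C^{1,1}$ norm over $\Omega\times[-R,R]\times\mathbb S^n$ is finite for every $R$, and suppose that this norm is at most $N$ for $R=M$. For a function $u$ on $\Omega$, let $M_u=\{X=(x,u(x)):x\in\Omega\}\subset\mathbb R^{n+1}$ be its graph, with unit upward normal $\nu=(-Du,1)/\sqrt{1+|Du|^2}$, first and second fundamental forms $g_{ij}=\delta_{ij}+u_iu_j$ and $h_{ij}=u_{ij}/\sqrt{1+|Du|^2}$, principal curvatures $\kappa_1,\dots,\kappa_n$ (the eigenvalues of $g^{-1}h$) and $H=\sum_i\kappa_i$. Put $\eta_{ij}=Hg_{ij}-h_{ij}$, and let $\lambda(\eta[M_u])$ be the vector of eigenvalues of $g^{-1}\eta$, that is,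 $\lambda_i=\sum_{j\ne i}\kappa_j$. Let $\sigma_m$ be the $m$-th elementary symmetric function, $\sigma_0=1$. Let $u\in C^4(\Omega)\cap C^2(\overline\Omega)$ be an admissible solution of $$\frac{\sigma_k}{\sigma_l}(\lambda(\eta[M_u]))=\psi(X,\nu)\ \text{ in }\Omega,\qquad u=0\ \text{ on }\partial\Omega,$$ where admissible means that $\sigma_i(\lambda(\eta[M_u]))>0$ for $1\le i\le k$ at every point of $M_u$, and suppose that $\|u\|_{C^1}=\sup_\Omega|u|+\sup_\Omega|Du|\le M$. Then $$\sup_{\overline\Omega}|D^2u|\le C\Big(1+\sup_{\partial\Omega}|D^2u|\Big),$$ where $D^2u$ on $\partial\Omega$ is the extension by continuity of $D^2u$ from $\Omega$. -/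

import Mathlib

open Set Filter Topology
open scoped NNReal ENNReal

noncomputable section

namespace GraphCurv

/-- The Euclidean space `ℝⁿ` containing the domain. -/
abbrev E (n : ℕ) : Type := EuclideanSpace ℝ (Fin n)

/-- The ambient Euclidean space `ℝⁿ⁺¹ = ℝⁿ × ℝ` (with the Euclidean norm) of the graph. -/
abbrev V (n : ℕ) : Type := WithLp 2 (E n × ℝ)

/-! ### Geometry of the graph `M_u = {(x, u x)}` -/

/-- The second derivative `D²u(x)`, as a bilinear form. -/
def D2 {n : ℕ} (u : E n → ℝ) (x : E n) : E n →L[ℝ] E n →L[ℝ] ℝ :=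
  fderiv ℝ (fderiv ℝ u) x

/-- The Hessian matrix `(u_ij)`. -/
def hess {n : ℕ} (u : E n → ℝ) (x : E n) : Matrix (Fin n) (Fin n) ℝ :=
  Matrix.of fun i j => D2 u x (EuclideanSpace.single i 1) (EuclideanSpace.single j 1)

/-- `ω = √(1 + |Du|²)`. -/
def slopeW {n : ℕ} (u : E n → ℝ) (x : E n) : ℝ :=
  Real.sqrt (1 + ‖gradient u x‖ ^ 2)

/-- The unit upward normal `ν = (-Du, 1) / √(1 + |Du|²)`. -/
def normal {n : ℕ} (u : E n → ℝ) (x : E n) : V n :=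
  (slopeW u x)⁻¹ • WithLp.toLp 2 (-gradient u x, (1 : ℝ))

/-- The first fundamental form `g_ij = δ_ij + u_i u_j`. -/
def firstForm {n : ℕ} (u : E n → ℝ) (x : E n) : Matrix (Fin n) (Fin n) ℝ :=
  Matrix.of fun i j => (if i = j then 1 else 0) + gradient u x i * gradient u x j

/-- The second fundamental form `h_ij = u_ij / √(1 + |Du|²)`. -/
def secondForm {n : ℕ} (u : E n → ℝ) (x : E n) : Matrix (Fin n) (Fin n) ℝ :=
  (slopeW u x)⁻¹ • hess u x

/-- The mean curvature `H = tr (g⁻¹ h)`, the sum of the principal curvatures. -/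
def meanCurv {n : ℕ} (u : E n → ℝ) (x : E n) : ℝ :=
  ((firstForm u x)⁻¹ * secondForm u x).trace

/-- The tensor `η_ij = H g_ij - h_ij`. -/
def etaForm {n : ℕ} (u : E n → ℝ) (x : E n) : Matrix (Fin n) (Fin n) ℝ :=
  meanCurv u x • firstForm u x - secondForm u x

/-- The (unordered) vector of the real eigenvalues of a matrix, with algebraic multiplicities.
It is only used for the matrices `g⁻¹ h` and `g⁻¹ η`, which have `n` real eigenvalues, as `g` is
positive definite and `h`, `η` are symmetric. -/
def eigs {n : ℕ} (A : Matrix (Fin n) (Fin n) ℝ) : Multiset ℝ := A.charpoly.roots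

/-- The principal curvatures `κ[M_u]` at the point `(x, u x)`: the eigenvalues of `g⁻¹ h`. -/
def principalCurv {n : ℕ} (u : E n → ℝ) (x : E n) : Multiset ℝ :=
  eigs ((firstForm u x)⁻¹ * secondForm u x)

/-- `λ(η[M_u])` at the point `(x, u x)`: the eigenvalues of `g⁻¹ η`. -/
def etaEigs {n : ℕ} (u : E n → ℝ) (x : E n) : Multiset ℝ :=
  eigs ((firstForm u x)⁻¹ * etaForm u x)

/-- The cone `Γ̃_k` of the `κ = (κ₁, …, κ_n)` for which `λ_i = ∑_{j ≠ i} κ_j` satisfies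
`σ_i(λ) > 0` for `1 ≤ i ≤ k`. Membership does not depend on the order of the `κ_i`. -/
def tildeGamma (k : ℕ) : Set (Multiset ℝ) :=
  {κ | ∀ i, 1 ≤ i → i ≤ k → 0 < (κ.map fun t => κ.sum - t).esymm i}

/-- `u` is admissible on `Ω`: its graph over `Ω` is `(η, k)`-convex. -/
def IsAdmissible {n : ℕ} (k : ℕ) (Ω : Set (E n)) (u : E n → ℝ) : Prop :=
  ∀ x ∈ Ω, principalCurv u x ∈ tildeGamma k

/-- The Dirichlet problem `σ_k/σ_l (λ(η[M_u])) = ψ(X, ν)` in `Ω`, `u = 0` on `∂Ω`.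
Of `ψ` only the values `ψ (x, z, ν)` with `|ν| = 1` are used. -/
structure SolvesDirichlet {n : ℕ} (k l : ℕ) (Ω : Set (E n)) (ψ : E n × ℝ × V n → ℝ)
    (u : E n → ℝ) : Prop where
  equation : ∀ x ∈ Ω, (etaEigs u x).esymm k / (etaEigs u x).esymm l = ψ (x, u x, normal u x)
  boundary : ∀ x ∈ frontier Ω, u x = 0

/-! ### Function spaces -/

/-- `f`, considered on `Ω`, has a continuous extension to the closure of `Ω`. -/
def ExtendsCont {n : ℕ} {F : Type} [TopologicalSpace F] (Ω : Set (E n)) (f : E n → F) : Prop :=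
  ∃ g : E n → F, ContinuousOn g (closure Ω) ∧ EqOn f g Ω

/-- `u ∈ C²(closure Ω)`: `u` is `C²` in `Ω`, continuous up to the boundary, and `Du`, `D²u`
have continuous extensions to the closure of `Ω`. -/
structure IsC2Closure {n : ℕ} (Ω : Set (E n)) (u : E n → ℝ) : Prop where
  contDiffOn : ContDiffOn ℝ 2 u Ω
  continuousOn : ContinuousOn u (closure Ω)
  grad_extends : ExtendsCont Ω (gradient u)
  hess_extends : ExtendsCont Ω (D2 u)

/-- `D²u` on the closure of `Ω`: the extension by continuity of `D²u` from `Ω`. -/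
def D2bar {n : ℕ} (Ω : Set (E n)) (u : E n → ℝ) : E n → (E n →L[ℝ] E n →L[ℝ] ℝ) :=
  extendFrom Ω (D2 u)

/-- The norm `‖u‖_{C¹} = sup |u| + sup |Du|` over `Ω`. -/
def c1Norm {n : ℕ} (Ω : Set (E n)) (u : E n → ℝ) : ℝ≥0∞ :=
  (⨆ x ∈ Ω, ‖u x‖ₑ) + ⨆ x ∈ Ω, ‖gradient u x‖ₑ

/-- The extension of a function of `(x, z, ν)`, `|ν| = 1`, that is homogeneous of degree `0`
in `ν`. Its derivative at points with `|ν| = 1` consists of the derivatives in `x` and `z` and the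
tangential derivative along the sphere. -/
def radialExt {n : ℕ} (f : E n × ℝ × V n → ℝ) (q : E n × ℝ × V n) : ℝ :=
  f (q.1, q.2.1, ‖q.2.2‖⁻¹ • q.2.2)

/-- The norm of `C^{1,1}` over `Ω × [-R, R] × 𝕊ⁿ`: supremum of `|f|`, supremum of the first
derivative, and Lipschitz constant of the first derivative. -/
def c11Norm {n : ℕ} (Ω : Set (E n)) (R : ℝ) (f : E n × ℝ × V n → ℝ) : ℝ≥0∞ :=
  let S : Set (E n × ℝ × V n) := Ω ×ˢ Icc (-R) R ×ˢ Metric.sphere 0 1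
  (⨆ q ∈ S, ‖f q‖ₑ) + (⨆ q ∈ S, ‖fderiv ℝ (radialExt f) q‖ₑ) +
    ⨆ q ∈ S, ⨆ q' ∈ S,
      edist (fderiv ℝ (radialExt f) q) (fderiv ℝ (radialExt f) q') / edist q q'

/-- `f ∈ C^{1,1}(closure Ω × ℝ × 𝕊ⁿ)`, with norms that are finite for bounded `z`. (The first
derivatives then extend continuously up to the boundary of `Ω`.) -/
structure IsC11 {n : ℕ} (Ω : Set (E n)) (f : E n × ℝ × V n → ℝ) : Prop where
  continuousOn : ContinuousOn f (closure Ω ×ˢ univ ×ˢ Metric.sphere 0 1)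
  differentiable : ∀ q ∈ Ω ×ˢ (univ : Set ℝ) ×ˢ Metric.sphere (0 : V n) 1,
    DifferentiableAt ℝ (radialExt f) q
  norm_lt_top : ∀ R : ℝ, c11Norm Ω R f < ⊤

end GraphCurv

end

/-!
# Global second derivative estimate for the quotient curvature equation in `λ(η)`

Since `k ≥ 2`, admissibility gives `H > 0` and `∑ κ_i² ≤ (n - 1)² H²`, so that it suffices to bound
the mean curvature `H`. Let `W = 1 / w` be the vertical component of the unit normal, where
`w = √(1 + |Du|²)`, and let `a = 1 / (2 (1 + M))`, so that `2 a ≤ W ≤ 1`. The test function is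
`H / (W - a)`. If its maximum over the closure of the domain is attained on the boundary, then `H` is
bounded by the second derivatives there; it remains to show that `H` is bounded at an interior maximum
(`meanCurv_le_of_touching`, `norm_D2_le_of_boundary`).

*The curvature function.* The function `F(κ) = (σ_k / σ_l)^{1 / (k - l)}(λ)`, `λ_i = ∑_{j ≠ i} κ_j`,
is concave (Newton's inequality, with the recursion of Marcus and Lopes: `Fquot_superadd`) and
homogeneous of degree one on the convex cone of admissible `κ`, and therefore has a supporting linear
function `∑ N_i κ_i` at each admissible `κ`. As `k < n`, the coordinate vectors belong to the cone, and
`N_i ≥ F(e_i) = c > 0`: the equation is uniformly elliptic (`exists_supergradient`). The diagonal of a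
symmetric operator in any orthonormal basis is a doubly stochastic average of its eigenvalues, so that
`F` of the eigenvalues is at most `∑ N_i` times the diagonal entries (`Fcurv_le_diagonal`). Thus at an
interior point the equation is touched by a linear one, and no derivatives of eigenvalues are needed.

*The point of maximum.* A linear isometry of the ambient space makes the tangent plane at the
maximum horizontal (`exists_rotated_graph`); then the graph is that of a function `v` with `Dv = 0` at the
origin, and the diagonal entries `m_i` of its shape operator in a principal basis satisfy
`(m_i)_jj = v_iijj - κ_j² κ_i - 2 κ_i³ δ_ij` there. The second order conditions for the touching along
the principal directions, for `H ≤ φ (W - a)` weighted by `N_j` and for `ψ^{1 / (k - l)} ≤ ∑ N_i m_i`,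
are added up: the fourth derivatives of `v` cancel by symmetry, the third ones are expressed by the
first order conditions, and what remains is a cubic inequality
`φ a c ∑ κ_i² ≤ C (H + φ ∑ |κ_i| + ∑ κ_i² + …)` (`touching_inequality`), which bounds `H`
(`curvature_bound`). The right-hand side has only Lipschitz first derivatives; its one-sided second
derivative along a curve is all that is used (`jet_le_of_touching`).
-/

noncomputable section

namespace GraphCurv

open scoped RealInnerProductSpace

variable {n : ℕ}

/-! ### Elementary symmetric functions and the Gårding cone -/

section Sym

variable {ι : Type*}

/-- The elementary symmetric function `σ_k` of the variables `x i`, `i ∈ s`. -/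
def esig (s : Finset ι) (k : ℕ) (x : ι → ℝ) : ℝ := ∑ t ∈ s.powersetCard k, ∏ i ∈ t, x i

@[simp] lemma esig_zero (s : Finset ι) (x : ι → ℝ) : esig s 0 x = 1 := by
  simp [esig]

lemma esig_one (s : Finset ι) (x : ι → ℝ) : esig s 1 x = ∑ i ∈ s, x i := by
  simp [esig, Finset.powersetCard_one]

lemma esig_empty_succ (k : ℕ) (x : ι → ℝ) : esig ∅ (k + 1) x = 0 := by
  rw [esig, Finset.powersetCard_eq_empty.2 (by simp), Finset.sum_empty]

lemma esig_smul (s : Finset ι) (k : ℕ) (t : ℝ) (x : ι → ℝ) :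
    esig s k (t • x) = t ^ k * esig s k x := by
  unfold esig
  rw [Finset.mul_sum]
  refine Finset.sum_congr rfl fun u hu => ?_
  simp [Finset.prod_mul_distrib, (Finset.mem_powersetCard.1 hu).2]

lemma differentiable_esig [Fintype ι] (s : Finset ι) (k : ℕ) : Differentiable ℝ (esig s k) := by
  unfold esig
  refine Differentiable.fun_sum fun t _ => ?_
  fun_prop

/-- The Gårding cone `Γ_k` in the variables `x i`, `i ∈ s`. -/
def Gam (s : Finset ι) (k : ℕ) (x : ι → ℝ) : Prop := ∀ j ≤ k, 0 < esig s j x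

lemma Gam.mono {s : Finset ι} {k k' : ℕ} (h : k ≤ k') {x : ι → ℝ} (hx : Gam s k' x) :
    Gam s k x := fun j hj => hx j (hj.trans h)

lemma Gam.smul {s : Finset ι} {k : ℕ} {x : ι → ℝ} (hx : Gam s k x) {t : ℝ} (ht : 0 < t) :
    Gam s k (t • x) := fun j hj => by
  rw [esig_smul]; exact mul_pos (pow_pos ht j) (hx j hj)

variable [DecidableEq ι]

lemma esig_insert {a : ι} {s : Finset ι} (h : a ∉ s) (k : ℕ) (x : ι → ℝ) :
    esig (insert a s) (k + 1) x = esig s (k + 1) x + x a * esig s k x := by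
  unfold esig
  rw [Finset.powersetCard_succ_insert h, Finset.sum_union, Finset.sum_image, Finset.mul_sum]
  · congr 1
    refine Finset.sum_congr rfl fun t ht => ?_
    rw [Finset.prod_insert]
    exact fun hat => h ((Finset.mem_powersetCard.1 ht).1 hat)
  · intro t ht t' ht' htt
    have h1 : a ∉ t := fun hat => h ((Finset.mem_powersetCard.1 ht).1 hat)
    have h2 : a ∉ t' := fun hat => h ((Finset.mem_powersetCard.1 ht').1 hat)
    rw [← Finset.erase_insert h1, htt, Finset.erase_insert h2]
  · rw [Finset.disjoint_left]
    intro t ht ht'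
    obtain ⟨t', -, rfl⟩ := Finset.mem_image.1 ht'
    exact h ((Finset.mem_powersetCard.1 ht).1 (Finset.mem_insert_self _ _))

lemma esig_erase {i : ι} {s : Finset ι} (h : i ∈ s) (k : ℕ) (x : ι → ℝ) :
    esig s (k + 1) x = esig (s.erase i) (k + 1) x + x i * esig (s.erase i) k x := by
  conv_lhs => rw [← Finset.insert_erase h]
  exact esig_insert (Finset.notMem_erase i s) k x

/-- Euler's identity for `σ_{k+1}`. -/
lemma sum_mul_esig_erase (s : Finset ι) (k : ℕ) (x : ι → ℝ) :
    ∑ i ∈ s, x i * esig (s.erase i) k x = (k + 1) * esig s (k + 1) x := by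
  induction s using Finset.induction_on generalizing k with
  | empty => simp [esig_empty_succ]
  | insert a s ha ih =>
    rw [Finset.sum_insert ha, Finset.erase_insert ha, esig_insert ha]
    have h1 : ∀ i ∈ s, (insert a s).erase i = insert a (s.erase i) := fun i hi =>
      Finset.erase_insert_of_ne (fun h => ha (h ▸ hi))
    cases k with
    | zero =>
      simp [esig_one]; ring
    | succ k =>
      have h2 : ∑ i ∈ s, x i * esig ((insert a s).erase i) (k + 1) x =
          ∑ i ∈ s, x i * esig (s.erase i) (k + 1) x +
            x a * ∑ i ∈ s, x i * esig (s.erase i) k x := by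
        rw [Finset.mul_sum, ← Finset.sum_add_distrib]
        refine Finset.sum_congr rfl fun i hi => ?_
        rw [h1 i hi, esig_insert (fun h => ha (Finset.mem_of_mem_erase h))]
        ring
      rw [h2, ih, ih]
      push_cast
      ring

open Polynomial in
lemma coeff_prod_one_add (s : Finset ι) (x : ι → ℝ) (k : ℕ) :
    (∏ i ∈ s, (1 + C (x i) * X : ℝ[X])).coeff k = esig s k x := by
  induction s using Finset.induction_on generalizing k with
  | empty =>
    cases k with
    | zero => simp
    | succ k => simp [esig_empty_succ, Polynomial.coeff_one]
  | insert a s ha ih =>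
    rw [Finset.prod_insert ha, add_mul, one_mul, coeff_add, mul_assoc, coeff_C_mul, ih]
    cases k with
    | zero => simp
    | succ k => rw [coeff_X_mul, ih, esig_insert ha]

open Polynomial in
/-- Rolle's theorem for real-rooted polynomials. -/
lemma splits_derivative_of_splits {p : ℝ[X]} (hp : p.Splits) : (derivative p).Splits := by
  rw [splits_iff_card_roots]
  have h1 := card_roots_le_derivative p
  rw [splits_iff_card_roots.1 hp] at h1
  have h2 := natDegree_derivative_le p
  have h3 := card_roots' (derivative p)
  by_cases h0 : p.natDegree = 0 <;> omega

open Polynomial in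
lemma splits_iterate_derivative {p : ℝ[X]} (hp : p.Splits) (k : ℕ) :
    (derivative^[k] p).Splits := by
  induction k with
  | zero => exact hp
  | succ k ih =>
    rw [Function.iterate_succ_apply']
    exact splits_derivative_of_splits ih

open Polynomial in
/-- Laguerre's inequality `p p'' ≤ p'²` for real-rooted polynomials. -/
lemma eval_mul_eval_derivative_two_le {p : ℝ[X]} (hp : p.Splits) (t : ℝ) :
    p.eval t * (derivative (derivative p)).eval t ≤ ((derivative p).eval t) ^ 2 := by
  have key : ∀ m : Multiset ℝ, ((m.map fun a => X - C a).prod : ℝ[X]).eval t *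
      (derivative (derivative ((m.map fun a => X - C a).prod : ℝ[X]))).eval t ≤
        ((derivative ((m.map fun a => X - C a).prod : ℝ[X])).eval t) ^ 2 := by
    intro m
    induction m using Multiset.induction_on with
    | empty => simp
    | cons a m ih =>
      rw [Multiset.map_cons, Multiset.prod_cons]
      set q : ℝ[X] := (m.map fun a => X - C a).prod
      simp only [derivative_mul, derivative_sub, derivative_X, derivative_C, sub_zero, one_mul,
        derivative_add, eval_add, eval_mul, eval_sub, eval_X, eval_C]
      nlinarith [sq_nonneg (eval t q), mul_nonneg (sq_nonneg (t - a)) (sub_nonneg.2 ih)]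
  have h := hp.eq_prod_roots
  rw [h]
  simp only [derivative_C_mul, eval_mul, eval_C]
  have := key p.roots
  nlinarith [mul_nonneg (sq_nonneg p.leadingCoeff) (sub_nonneg.2 this)]

open Polynomial in
/-- Newton's inequality, without the sharp constant, for real numbers of any sign. -/
lemma esig_mul_esig_le (s : Finset ι) (x : ι → ℝ) (k : ℕ) :
    esig s k x * esig s (k + 2) x ≤ esig s (k + 1) x ^ 2 := by
  set p : ℝ[X] := ∏ i ∈ s, (1 + C (x i) * X : ℝ[X]) with hp
  have hs : p.Splits := by
    refine Splits.prod fun i _ => ?_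
    refine Splits.of_natDegree_le_one ?_
    compute_degree
  have h := eval_mul_eval_derivative_two_le (splits_iterate_derivative hs k) 0
  have hc : ∀ j, (derivative^[j] p).eval 0 = (j.factorial : ℝ) * esig s j x := by
    intro j
    rw [← coeff_zero_eq_eval_zero, coeff_iterate_derivative, zero_add, Nat.descFactorial_self,
      hp, coeff_prod_one_add, nsmul_eq_mul]
  rw [← Function.iterate_succ_apply' derivative, ← Function.iterate_succ_apply' derivative,
    hc, hc, hc] at h
  rcases le_or_gt (esig s k x * esig s (k + 2) x) 0 with h0 | h0
  · exact h0.trans (sq_nonneg _)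
  · have hk : (0 : ℝ) < k.factorial := by exact_mod_cast k.factorial_pos
    simp only [Nat.succ_eq_add_one, Nat.factorial_succ] at h
    push_cast at h
    have hk0 : (0 : ℝ) ≤ k := Nat.cast_nonneg k
    have h1 : ((k : ℝ) + 1 + 1) * (esig s k x * esig s (k + 2) x) ≤
        ((k : ℝ) + 1) * esig s (k + 1) x ^ 2 := by
      have h2 : (0 : ℝ) < (k + 1) * (k.factorial : ℝ) ^ 2 := by positivity
      refine le_of_mul_le_mul_left ?_ h2
      calc _ = _ := ?_
        _ ≤ _ := h
        _ = _ := ?_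
      · ring
      · ring
    nlinarith

/-- Omitting a variable maps `Γ_{k+1}` to `Γ_k`: were `σ_{j+1}` without `x i` nonpositive, the
positivity of `σ_{j+1}` and `σ_{j+2}` would contradict Newton's inequality. -/
lemma Gam.erase {s : Finset ι} {k : ℕ} {x : ι → ℝ} (hx : Gam s (k + 1) x) {i : ι}
    (hi : i ∈ s) : Gam (s.erase i) k x := by
  intro j
  induction j with
  | zero => intro _; simp
  | succ j ih =>
    intro hj
    have h0 := ih (by omega)
    by_contra! hneg
    have h1 := hx (j + 1) (by omega)
    have h2 := hx (j + 2) (by omega)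
    rw [esig_erase hi] at h1 h2
    have hN := esig_mul_esig_le (s.erase i) x j
    set a := esig (s.erase i) j x
    set b := esig (s.erase i) (j + 1) x
    set d := esig (s.erase i) (j + 2) x
    nlinarith [mul_nonneg (neg_nonneg.2 hneg) h1.le, mul_pos h0 h2]

/-- The quotient `σ_{k+1} / σ_k`. -/
def qsig (s : Finset ι) (k : ℕ) (x : ι → ℝ) : ℝ := esig s (k + 1) x / esig s k x

/-- The recursion of Marcus and Lopes, which expresses a quotient `σ_{k+2} / σ_{k+1}` through
the quotients `σ_{k+1} / σ_k` in one variable less. -/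
lemma qsig_succ {s : Finset ι} {k : ℕ} {x : ι → ℝ} (hx : Gam s (k + 1) x) :
    ((k : ℝ) + 2) * qsig s (k + 1) x =
      ∑ i ∈ s, (x i - x i ^ 2 / (x i + qsig (s.erase i) k x)) ∧
      ∀ i ∈ s, 0 < x i + qsig (s.erase i) k x := by
  have hpos : ∀ i ∈ s, x i + qsig (s.erase i) k x = esig s (k + 1) x / esig (s.erase i) k x := by
    intro i hi
    have h0 := hx.erase hi k le_rfl
    rw [qsig, esig_erase hi]
    field_simp
    ring
  refine ⟨?_, fun i hi => ?_⟩
  · have h := sum_mul_esig_erase s (k + 1) x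
    have h1 := hx (k + 1) le_rfl
    have h2 : ((k : ℝ) + 2) * qsig s (k + 1) x =
        ∑ i ∈ s, x i * esig (s.erase i) (k + 1) x / esig s (k + 1) x := by
      rw [← Finset.sum_div, h, qsig]
      push_cast
      ring
    rw [h2]
    refine Finset.sum_congr rfl fun i hi => ?_
    have h0 := hx.erase hi k le_rfl
    rw [hpos i hi]
    have h3 := esig_erase hi k x
    have h4 : esig (s.erase i) (k + 1) x = esig s (k + 1) x - x i * esig (s.erase i) k x := by
      linarith
    rw [h4]
    field_simp
  · rw [hpos i hi]
    exact div_pos (hx _ le_rfl) (hx.erase hi k le_rfl)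

lemma sq_div_add_sq_div_ge {a b p q r : ℝ} (hp : 0 < a + p) (hq : 0 < b + q) (h : p + q ≤ r) :
    (a + b) ^ 2 / (a + b + r) ≤ a ^ 2 / (a + p) + b ^ 2 / (b + q) := by
  have h1 : (a + b) ^ 2 / (a + b + r) ≤ (a + b) ^ 2 / ((a + p) + (b + q)) :=
    div_le_div_of_nonneg_left (sq_nonneg _) (by linarith) (by linarith)
  refine h1.trans ?_
  rw [div_add_div _ _ hp.ne' hq.ne', div_le_div_iff₀ (by linarith) (mul_pos hp hq)]
  nlinarith [mul_nonneg (mul_pos hp hq).le (sq_nonneg 1), sq_nonneg (a * (b + q) - b * (a + p))]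

/-- `Γ_{k+1}` is closed under addition, and `σ_{k+1} / σ_k` is superadditive on it. -/
lemma Gam.add {k : ℕ} : ∀ {s : Finset ι} {x y : ι → ℝ}, Gam s (k + 1) x → Gam s (k + 1) y →
    Gam s (k + 1) (x + y) ∧ qsig s k x + qsig s k y ≤ qsig s k (x + y) := by
  induction k with
  | zero =>
    intro s x y hx hy
    have h : esig s 1 (x + y) = esig s 1 x + esig s 1 y := by
      simp [esig_one, Finset.sum_add_distrib]
    refine ⟨fun j hj => ?_, by simp [qsig, h]⟩
    interval_cases j
    · simp
    · rw [h]; exact add_pos (hx 1 le_rfl) (hy 1 le_rfl)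
  | succ k ih =>
    intro s x y hx hy
    have hx' := hx.mono (Nat.le_succ _)
    have hy' := hy.mono (Nat.le_succ _)
    have hxy := (ih hx' hy').1
    obtain ⟨ex, px⟩ := qsig_succ hx'
    obtain ⟨ey, py⟩ := qsig_succ hy'
    obtain ⟨exy, pxy⟩ := qsig_succ hxy
    have hk : (0 : ℝ) < k + 2 := by positivity
    have hq : qsig s (k + 1) x + qsig s (k + 1) y ≤ qsig s (k + 1) (x + y) := by
      refine le_of_mul_le_mul_left ?_ hk
      rw [mul_add, ex, ey, exy, ← Finset.sum_add_distrib]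
      refine Finset.sum_le_sum fun i hi => ?_
      have := sq_div_add_sq_div_ge (px i hi) (py i hi) (ih (hx.erase hi) (hy.erase hi)).2
      simp only [Pi.add_apply]
      linarith
    refine ⟨fun j hj => ?_, hq⟩
    rcases Nat.lt_or_eq_of_le hj with h | rfl
    · exact hxy j (by omega)
    · have h1 : 0 < qsig s (k + 1) (x + y) := by
        have := div_pos (hx (k + 2) le_rfl) (hx (k + 1) (by omega))
        have := div_pos (hy (k + 2) le_rfl) (hy (k + 1) (by omega))
        unfold qsig at *
        linarith
      have h2 := hxy (k + 1) le_rfl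
      have := mul_pos h1 h2
      rwa [qsig, div_mul_cancel₀ _ h2.ne'] at this

/-- The geometric mean is superadditive. -/
lemma geom_mean_superadd {α : Type*} (s : Finset α) (hs : s.Nonempty) (a b c : α → ℝ)
    (ha : ∀ i ∈ s, 0 < a i) (hb : ∀ i ∈ s, 0 < b i) (hc : ∀ i ∈ s, a i + b i ≤ c i) :
    (∏ i ∈ s, a i) ^ (1 / (s.card : ℝ)) + (∏ i ∈ s, b i) ^ (1 / (s.card : ℝ)) ≤
      (∏ i ∈ s, c i) ^ (1 / (s.card : ℝ)) := by
  have hcp : ∀ i ∈ s, 0 < c i := fun i hi => by linarith [ha i hi, hb i hi, hc i hi]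
  have hcard : (0 : ℝ) < s.card := by exact_mod_cast hs.card_pos
  have amgm : ∀ d : α → ℝ, (∀ i ∈ s, 0 < d i) →
      (∏ i ∈ s, d i) ^ (1 / (s.card : ℝ)) ≤
        (∑ i ∈ s, 1 / (s.card : ℝ) * (d i / c i)) * (∏ i ∈ s, c i) ^ (1 / (s.card : ℝ)) := by
    intro d hd
    have h := Real.geom_mean_le_arith_mean_weighted s (fun _ => 1 / (s.card : ℝ))
      (fun i => d i / c i) (fun _ _ => by positivity) (by simp [hcard.ne'])
      (fun i hi => (div_pos (hd i hi) (hcp i hi)).le)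
    rw [Real.finsetProd_rpow _ _ (fun i hi => (div_pos (hd i hi) (hcp i hi)).le),
      Finset.prod_div_distrib, Real.div_rpow (Finset.prod_nonneg fun i hi => (hd i hi).le)
        (Finset.prod_nonneg fun i hi => (hcp i hi).le)] at h
    rwa [div_le_iff₀ (Real.rpow_pos_of_pos (Finset.prod_pos hcp) _)] at h
  refine (add_le_add (amgm a ha) (amgm b hb)).trans ?_
  rw [← add_mul]
  refine mul_le_of_le_one_left (Real.rpow_nonneg (Finset.prod_nonneg fun i hi => (hcp i hi).le) _) ?_
  rw [← Finset.sum_add_distrib]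
  calc _ ≤ ∑ i ∈ s, 1 / (s.card : ℝ) := by
        refine Finset.sum_le_sum fun i hi => ?_
        rw [← mul_add, ← add_div]
        exact mul_le_of_le_one_right (by positivity) ((div_le_one (hcp i hi)).2 (hc i hi))
    _ = 1 := by simp [hcard.ne']

/-- The function `(σ_k / σ_l)^{1/(k-l)}`. -/
def Fquot (s : Finset ι) (k l : ℕ) (x : ι → ℝ) : ℝ :=
  (esig s k x / esig s l x) ^ (1 / ((k : ℝ) - (l : ℝ)))

lemma prod_qsig {s : Finset ι} {k l : ℕ} (hlk : l ≤ k) {x : ι → ℝ} (hx : Gam s k x) :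
    ∏ j ∈ Finset.Ico l k, qsig s j x = esig s k x / esig s l x := by
  induction k, hlk using Nat.le_induction with
  | base => simp [(hx l le_rfl).ne']
  | succ k hk ih =>
    rw [Finset.prod_Ico_succ_top hk, ih (hx.mono (Nat.le_succ _)), qsig]
    have h1 := hx k (Nat.le_succ _)
    have h2 := hx l (by omega)
    field_simp

lemma Fquot_superadd {s : Finset ι} {k l : ℕ} (hlk : l < k) {x y : ι → ℝ} (hx : Gam s k x)
    (hy : Gam s k y) :
    Gam s k (x + y) ∧ Fquot s k l x + Fquot s k l y ≤ Fquot s k l (x + y) := by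
  have hxy : Gam s k (x + y) := by
    obtain ⟨k, rfl⟩ : ∃ k', k = k' + 1 := ⟨k - 1, by omega⟩
    exact (hx.add hy).1
  refine ⟨hxy, ?_⟩
  unfold Fquot
  rw [← prod_qsig hlk.le hx, ← prod_qsig hlk.le hy, ← prod_qsig hlk.le hxy]
  have hcard : ((Finset.Ico l k).card : ℝ) = (k : ℝ) - l := by
    rw [Nat.card_Ico, Nat.cast_sub hlk.le]
  rw [← hcard]
  have hpos : ∀ {z : ι → ℝ}, Gam s k z → ∀ j ∈ Finset.Ico l k, 0 < qsig s j z := by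
    intro z hz j hj
    have := (Finset.mem_Ico.1 hj).2
    exact div_pos (hz _ (by omega)) (hz _ (by omega))
  refine geom_mean_superadd _ (Finset.nonempty_Ico.2 hlk) _ _ _ (hpos hx) (hpos hy) ?_
  intro j hj
  have := (Finset.mem_Ico.1 hj).2
  exact ((hx.mono (show j + 1 ≤ k by omega)).add (hy.mono (show j + 1 ≤ k by omega))).2

lemma Fquot_smul {s : Finset ι} {k l : ℕ} (hlk : l < k) {x : ι → ℝ} (hx : Gam s k x) {t : ℝ}
    (ht : 0 < t) : Fquot s k l (t • x) = t * Fquot s k l x := by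
  unfold Fquot
  have h1 := hx k le_rfl
  have h2 := hx l hlk.le
  have h3 : t ^ k = t ^ l * t ^ (k - l) := by rw [← pow_add]; congr 1; omega
  have h4 : esig s k (t • x) / esig s l (t • x) =
      t ^ (k - l) * (esig s k x / esig s l x) := by
    rw [esig_smul, esig_smul, h3]
    field_simp
  have h5 : (0 : ℝ) < (k : ℝ) - l := by
    have : (l : ℝ) < k := by exact_mod_cast hlk
    linarith
  rw [h4, Real.mul_rpow (by positivity) (div_pos h1 h2).le, ← Real.rpow_natCast,
    ← Real.rpow_mul ht.le, Nat.cast_sub hlk.le, mul_one_div_cancel h5.ne', Real.rpow_one]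

lemma differentiableAt_Fquot [Fintype ι] {s : Finset ι} {k l : ℕ} (hlk : l < k) {x : ι → ℝ}
    (hx : Gam s k x) : DifferentiableAt ℝ (Fquot s k l) x := by
  unfold Fquot
  have h1 := hx k le_rfl
  have h2 := hx l hlk.le
  refine DifferentiableAt.rpow_const ?_ (Or.inl (div_pos h1 h2).ne')
  exact ((differentiable_esig s k).differentiableAt).fun_mul
    ((differentiable_esig s l).differentiableAt.fun_inv h2.ne')

/-- A function that is superadditive and positively homogeneous on a convex cone lies below its
linearization at a point of differentiability. -/
lemma le_fderiv_of_superadd {E : Type*} [NormedAddCommGroup E] [NormedSpace ℝ E] {K : Set E}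
    {F : E → ℝ} {x : E} (hF : DifferentiableAt ℝ F x)
    (hs : ∀ y ∈ K, ∀ t : ℝ, 0 < t → F x + t * F y ≤ F (x + t • y))
    (hh : ∀ t : ℝ, 0 < t → F (t • x) = t * F x) :
    (∀ y ∈ K, F y ≤ fderiv ℝ F x y) ∧ fderiv ℝ F x x = F x := by
  have hd : ∀ y, Tendsto (fun t : ℝ => t⁻¹ • (F (x + t • y) - F x)) (𝓝[>] 0)
      (𝓝 (fderiv ℝ F x y)) := by
    intro y
    have := hF.hasFDerivAt.hasLineDerivAt y
    have h2 := (hasDerivAt_iff_tendsto_slope_zero.1 this)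
    simp only [zero_add, zero_smul, add_zero] at h2
    exact h2.mono_left (nhdsWithin_mono _ fun t (ht : 0 < t) => ht.ne')
  refine ⟨fun y hy => ge_of_tendsto (hd y) ?_, ?_⟩
  · filter_upwards [self_mem_nhdsWithin] with t (ht : 0 < t)
    rw [smul_eq_mul, ← div_eq_inv_mul, le_div_iff₀ ht]
    linarith [hs y hy t ht]
  · refine tendsto_nhds_unique (hd x) (tendsto_const_nhds.congr' ?_)
    filter_upwards [self_mem_nhdsWithin] with t (ht : 0 < t)
    have : x + t • x = (1 + t) • x := by rw [add_smul, one_smul]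
    rw [this, hh _ (by linarith), smul_eq_mul]
    field_simp
    ring

end Sym

/-! ### The curvature function in terms of the principal curvatures -/

/-- The vector `λ_i = ∑_{j ≠ i} κ_j`. -/
def lam (κ : Fin n → ℝ) : Fin n → ℝ := fun i => ∑ j, κ j - κ i

lemma lam_add (κ κ' : Fin n → ℝ) : lam (κ + κ') = lam κ + lam κ' := by
  funext i; simp [lam, Finset.sum_add_distrib]; ring

lemma lam_smul (t : ℝ) (κ : Fin n → ℝ) : lam (t • κ) = t • lam κ := by
  funext i; simp [lam, ← Finset.mul_sum]; ring

/-- The function `(σ_k / σ_l)^{1/(k-l)}(λ)` of the principal curvatures. -/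
def Fcurv (k l : ℕ) (κ : Fin n → ℝ) : ℝ := Fquot Finset.univ k l (lam κ)

/-- The cone `Γ̃_k` for ordered tuples of principal curvatures. -/
def Cone (k : ℕ) (κ : Fin n → ℝ) : Prop := Gam Finset.univ k (lam κ)

lemma Cone.smul {k : ℕ} {κ : Fin n → ℝ} (h : Cone k κ) {t : ℝ} (ht : 0 < t) : Cone k (t • κ) := by
  unfold Cone
  rw [lam_smul]
  exact Gam.smul h ht

lemma esig_lam_single (i : Fin n) (j : ℕ) :
    esig Finset.univ j (lam (Pi.single i (1 : ℝ))) = ((n - 1).choose j : ℝ) := by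
  cases j with
  | zero => simp
  | succ j =>
    rw [esig_erase (Finset.mem_univ i)]
    have h0 : lam (Pi.single i (1 : ℝ)) i = 0 := by simp [lam]
    rw [h0, zero_mul, add_zero, esig]
    have h1 : ∀ t ∈ (Finset.univ.erase i).powersetCard (j + 1),
        ∏ m ∈ t, lam (Pi.single i (1 : ℝ)) m = 1 := by
      intro t ht
      refine Finset.prod_eq_one fun m hm => ?_
      have : m ≠ i := Finset.ne_of_mem_erase ((Finset.mem_powersetCard.1 ht).1 hm)
      simp [lam, this]
    rw [Finset.sum_congr rfl h1]
    simp [Finset.card_powersetCard]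

/-- As `k < n`, the coordinate vectors belong to the cone. -/
lemma cone_single {k : ℕ} (hkn : k < n) (i : Fin n) : Cone k (Pi.single i (1 : ℝ)) := by
  intro j hj
  rw [esig_lam_single]
  exact_mod_cast Nat.choose_pos (by omega)

/-- The curvature function has at every point of the cone a supporting linear function from above.
Its coefficients have a uniform lower bound: they are at least the values of the function at the
coordinate vectors, which lie in the cone. -/
theorem exists_supergradient (n k l : ℕ) (hlk : l < k) (hkn : k < n) :
    ∃ c : ℝ, 0 < c ∧ ∀ κ : Fin n → ℝ, Cone k κ → ∃ N : Fin n → ℝ, (∀ i, c ≤ N i) ∧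
      (∀ κ', Cone k κ' → Fcurv k l κ' ≤ ∑ i, N i * κ' i) ∧ ∑ i, N i * κ i = Fcurv k l κ := by
  refine ⟨(((n - 1).choose k : ℝ) / ((n - 1).choose l : ℝ)) ^ (1 / ((k : ℝ) - (l : ℝ))), ?_, ?_⟩
  · have h1 : 0 < (n - 1).choose k := Nat.choose_pos (by omega)
    have h2 : 0 < (n - 1).choose l := Nat.choose_pos (by omega)
    positivity
  intro κ hκ
  have hlam : Differentiable ℝ (lam : (Fin n → ℝ) → (Fin n → ℝ)) := by
    unfold lam; fun_prop
  have hd : DifferentiableAt ℝ (Fcurv k l : (Fin n → ℝ) → ℝ) κ :=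
    DifferentiableAt.comp (g := Fquot Finset.univ k l) κ (differentiableAt_Fquot hlk hκ)
      hlam.differentiableAt
  have hsm : ∀ y : Fin n → ℝ, Cone k y → ∀ t : ℝ, 0 < t →
      Fcurv k l (t • y) = t * Fcurv k l y := by
    intro y hy t ht
    unfold Fcurv
    rw [lam_smul, Fquot_smul hlk hy ht]
  obtain ⟨h1, h2⟩ := le_fderiv_of_superadd (K := {y | Cone k y}) hd
    (fun y hy t ht => by
      rw [← hsm y hy t ht]
      unfold Fcurv
      rw [lam_add]
      exact (Fquot_superadd hlk hκ (hy.smul ht)).2) (hsm κ hκ)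
  have hsum : ∀ y : Fin n → ℝ, fderiv ℝ (Fcurv k l) κ y =
      ∑ i, fderiv ℝ (Fcurv k l) κ (Pi.single i 1) * y i := by
    intro y
    conv_lhs => rw [← Finset.univ_sum_single y, map_sum]
    refine Finset.sum_congr rfl fun i _ => ?_
    have : (Pi.single i (y i) : Fin n → ℝ) = y i • Pi.single i (1 : ℝ) := by
      rw [← Pi.single_smul, smul_eq_mul, mul_one]
    rw [this, map_smul, smul_eq_mul, mul_comm]
  refine ⟨fun i => fderiv ℝ (Fcurv k l) κ (Pi.single i 1), fun i => ?_, fun κ' h' => ?_, ?_⟩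
  · have := h1 _ (cone_single hkn i)
    simp only [Fcurv, Fquot, esig_lam_single] at this
    exact this
  · rw [← hsum]; exact h1 _ h'
  · rw [← hsum]; exact h2

lemma esig_eq_esymm (k : ℕ) (x : Fin n → ℝ) :
    esig Finset.univ k x = (Finset.univ.val.map x).esymm k := by
  rw [Finset.esymm_map_val, esig]

lemma Fcurv_comp_perm (k l : ℕ) (κ : Fin n → ℝ) (π : Equiv.Perm (Fin n)) :
    (Cone k κ → Cone k (κ ∘ π)) ∧ Fcurv k l (κ ∘ π) = Fcurv k l κ := by
  have hl : lam (κ ∘ π) = lam κ ∘ π := by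
    funext i
    simp [lam, Equiv.sum_comp π κ]
  have h : ∀ j, esig Finset.univ j (lam (κ ∘ π)) = esig Finset.univ j (lam κ) := by
    intro j
    rw [esig_eq_esymm, esig_eq_esymm, hl, ← Multiset.map_map]
    congr 2
    have := congrArg Finset.val (Finset.map_univ_equiv π)
    simpa [Finset.map_val] using this
  refine ⟨fun hκ j hj => by rw [h]; exact hκ j hj, ?_⟩
  unfold Fcurv Fquot
  rw [h, h]

/-- A supporting linear function also dominates the curvature function after averaging the
curvatures by a doubly stochastic matrix. -/
lemma Fcurv_le_of_doublyStochastic {k l : ℕ} {N : Fin n → ℝ}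
    (hN : ∀ κ', Cone k κ' → Fcurv k l κ' ≤ ∑ i, N i * κ' i) {κ : Fin n → ℝ} (hκ : Cone k κ)
    {P : Matrix (Fin n) (Fin n) ℝ} (hP : P ∈ doublyStochastic ℝ (Fin n)) :
    Fcurv k l κ ≤ ∑ i, N i * ∑ j, P i j * κ j := by
  obtain ⟨w, hw0, hw1, rfl⟩ := exists_eq_sum_perm_of_mem_doublyStochastic hP
  have h1 : ∀ π : Equiv.Perm (Fin n), Fcurv k l κ ≤ ∑ i, N i * κ (π i) := fun π => by
    have := hN _ ((Fcurv_comp_perm k l κ π).1 hκ)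
    rwa [(Fcurv_comp_perm k l κ π).2] at this
  calc Fcurv k l κ = ∑ π, w π * Fcurv k l κ := by rw [← Finset.sum_mul, hw1, one_mul]
    _ ≤ ∑ π, w π * ∑ i, N i * κ (π i) :=
        Finset.sum_le_sum fun π _ => mul_le_mul_of_nonneg_left (h1 π) (hw0 π)
    _ = _ := by
        simp only [Matrix.sum_apply, Matrix.smul_apply, Equiv.Perm.permMatrix,
          PEquiv.toMatrix_apply, Equiv.toPEquiv_apply, Finset.mul_sum, Finset.sum_mul]
        rw [Finset.sum_comm]
        refine Finset.sum_congr rfl fun i _ => ?_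
        rw [Finset.sum_comm]
        refine Finset.sum_congr rfl fun π _ => ?_
        simp [eq_comm]
        ring

/-- In the cone with `k ≥ 2` the sum of the curvatures is positive and controls all of them. -/
lemma Cone.sum_pos_and_sq_le {k : ℕ} (hk : 2 ≤ k) (hn : 2 ≤ n) {κ : Fin n → ℝ} (h : Cone k κ) :
    0 < ∑ i, κ i ∧ ∑ i, κ i ^ 2 ≤ ((n : ℝ) - 1) ^ 2 * (∑ i, κ i) ^ 2 := by
  have hn' : (2 : ℝ) ≤ n := by exact_mod_cast hn
  set H := ∑ i, κ i with hH
  have hs : ∑ i, lam κ i = ((n : ℝ) - 1) * H := by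
    simp [lam, Finset.sum_sub_distrib, ← hH]; ring
  have h1 := h 1 (by omega)
  rw [esig_one, hs] at h1
  have hpos : 0 < H := pos_of_mul_pos_right h1 (by linarith)
  refine ⟨hpos, ?_⟩
  have h2 := h 2 hk
  have h3 := sum_mul_esig_erase Finset.univ 1 (lam κ)
  have h4 : ∀ i, esig (Finset.univ.erase i) 1 (lam κ) = ((n : ℝ) - 1) * H - lam κ i := by
    intro i
    rw [esig_one, ← hs, ← Finset.sum_erase_add _ _ (Finset.mem_univ i)]
    ring
  simp only [h4] at h3
  have h5 : ∑ i, lam κ i * (((n : ℝ) - 1) * H - lam κ i) =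
      (((n : ℝ) - 1) * H) ^ 2 - ∑ i, lam κ i ^ 2 := by
    simp only [mul_sub, Finset.sum_sub_distrib, ← Finset.sum_mul, hs]
    simp only [← sq]
  have h6 : ∑ i, lam κ i ^ 2 = ((n : ℝ) - 2) * H ^ 2 + ∑ i, κ i ^ 2 := by
    have : ∀ i, lam κ i ^ 2 = H ^ 2 - 2 * H * κ i + κ i ^ 2 := fun i => by simp [lam, ← hH]; ring
    simp only [this, Finset.sum_add_distrib, Finset.sum_sub_distrib, ← Finset.mul_sum, ← hH]
    simp
    ring
  norm_num at h3
  nlinarith [mul_nonneg (sub_nonneg.2 hn') (sq_nonneg H)]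

/-! ### The shape operator of a graph -/

/-- `√(1 + |p|²)`, as a function of the gradient `p`. -/
def wf (p : E n) : ℝ := Real.sqrt (1 + ‖p‖ ^ 2)

lemma wf_sq (p : E n) : wf p ^ 2 = 1 + ‖p‖ ^ 2 := Real.sq_sqrt (by positivity)

lemma wf_pos (p : E n) : 0 < wf p := Real.sqrt_pos.2 (by positivity)

lemma one_le_wf (p : E n) : 1 ≤ wf p := Real.one_le_sqrt.2 (by nlinarith [sq_nonneg ‖p‖])

@[simp] lemma wf_zero : wf (0 : E n) = 1 := by simp [wf]

/-- The Hessian of `u` as an operator, the derivative of the gradient. -/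
def hessOp (u : E n → ℝ) (x : E n) : E n →L[ℝ] E n := fderiv ℝ (gradient u) x

/-- The inverse of the Riesz isomorphism `p ↦ ⟪p, ·⟫`, written in coordinates so that it is a
continuous `ℝ`-linear map by construction. -/
def rieszInv : (E n →L[ℝ] ℝ) →L[ℝ] E n :=
  ∑ i, (ContinuousLinearMap.apply ℝ ℝ (EuclideanSpace.single i (1 : ℝ))).smulRight
    (EuclideanSpace.single i (1 : ℝ))

lemma gradient_eq_rieszInv (u : E n → ℝ) : gradient u = fun x => rieszInv (fderiv ℝ u x) := by
  funext x
  ext i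
  have h : ⟪gradient u x, EuclideanSpace.single i (1 : ℝ)⟫ =
      fderiv ℝ u x (EuclideanSpace.single i 1) := by
    rw [← toDual_gradient, InnerProductSpace.toDual_apply_apply]
  rw [EuclideanSpace.inner_single_right] at h
  simp only [one_mul, conj_trivial] at h
  rw [h]
  simp [rieszInv, Finset.sum_apply, Pi.single_apply]

lemma inner_gradient (u : E n → ℝ) (x ζ : E n) : ⟪gradient u x, ζ⟫ = fderiv ℝ u x ζ := by
  rw [← toDual_gradient, InnerProductSpace.toDual_apply_apply]

lemma contDiffAt_gradient {u : E n → ℝ} {x : E n} {m k : WithTop ℕ∞} (h : ContDiffAt ℝ k u x)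
    (hm : m + 1 ≤ k) : ContDiffAt ℝ m (gradient u) x := by
  rw [gradient_eq_rieszInv]
  exact rieszInv.contDiff.contDiffAt.comp x (h.fderiv_right hm)

lemma hasFDerivAt_gradient {u : E n → ℝ} {x : E n} (h : ContDiffAt ℝ 2 u x) :
    HasFDerivAt (gradient u) (hessOp u x) x :=
  ((contDiffAt_gradient (m := 1) h (by norm_num)).differentiableAt (by norm_num)).hasFDerivAt

lemma inner_hessOp {u : E n → ℝ} {x : E n} (h : ContDiffAt ℝ 2 u x) (ξ ζ : E n) :
    ⟪hessOp u x ξ, ζ⟫ = D2 u x ξ ζ := by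
  have h1 : HasFDerivAt (fun y => ⟪gradient u y, ζ⟫) ((innerSL ℝ ζ).comp (hessOp u x)) x := by
    have := (innerSL ℝ ζ).hasFDerivAt.comp x (hasFDerivAt_gradient h)
    refine this.congr_of_eventuallyEq (Eventually.of_forall fun y => ?_)
    simp
  have h2 : HasFDerivAt (fun y => fderiv ℝ u y ζ) ((D2 u x).flip ζ) x := by
    have h3 : HasFDerivAt (fderiv ℝ u) (D2 u x) x :=
      ((h.fderiv_right (m := 1) (by norm_num)).differentiableAt (by norm_num)).hasFDerivAt
    exact (h3.clm_apply (hasFDerivAt_const ζ x)).congr_fderiv (by ext; simp)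
  have h4 := h1.unique (h2.congr_of_eventuallyEq (Eventually.of_forall fun y => inner_gradient u y ζ))
  have h5 := congrArg (fun L : E n →L[ℝ] ℝ => L ξ) h4
  simpa [real_inner_comm] using h5

lemma D2_symm {u : E n → ℝ} {x : E n} (h : ContDiffAt ℝ 2 u x) (ξ ζ : E n) :
    D2 u x ξ ζ = D2 u x ζ ξ :=
  (h.isSymmSndFDerivAt (by simp)) ξ ζ

lemma hessOp_symm {u : E n → ℝ} {x : E n} (h : ContDiffAt ℝ 2 u x) (ξ ζ : E n) :
    ⟪hessOp u x ξ, ζ⟫ = ⟪ξ, hessOp u x ζ⟫ := by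
  rw [inner_hessOp h, D2_symm h, ← inner_hessOp h, real_inner_comm]

/-- The shape operator `g⁻¹ h` of a graph, in terms of the gradient `p` and the Hessian `B`. -/
def wein (p : E n) (B : E n →L[ℝ] E n) : E n →L[ℝ] E n :=
  (wf p)⁻¹ • (B - ((wf p)⁻¹ ^ 2) • ((innerSL ℝ p).comp B).smulRight p)

lemma wein_apply (p : E n) (B : E n →L[ℝ] E n) (ξ : E n) :
    wein p B ξ = (wf p)⁻¹ • (B ξ - ((wf p)⁻¹ ^ 2 * ⟪p, B ξ⟫) • p) := by
  simp [wein, smul_smul]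

lemma inner_wein (p : E n) (B : E n →L[ℝ] E n) (ξ : E n) :
    ⟪p, wein p B ξ⟫ = (wf p)⁻¹ ^ 3 * ⟪p, B ξ⟫ := by
  rw [wein_apply, inner_smul_right, inner_sub_right, inner_smul_right, real_inner_self_eq_norm_sq]
  have h := wf_sq p
  have h0 := wf_pos p
  have h1 : ‖p‖ ^ 2 = wf p ^ 2 - 1 := by linarith
  rw [h1]
  field_simp
  ring

lemma wein_add (p : E n) (B : E n →L[ℝ] E n) (ξ : E n) :
    wein p B ξ + ⟪p, wein p B ξ⟫ • p = (wf p)⁻¹ • B ξ := by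
  rw [inner_wein, wein_apply, smul_sub, smul_smul]
  have : (wf p)⁻¹ * ((wf p)⁻¹ ^ 2 * ⟪p, B ξ⟫) = (wf p)⁻¹ ^ 3 * ⟪p, B ξ⟫ := by ring
  rw [this]
  abel

/-- The standard basis. -/
def stdB (n : ℕ) : Module.Basis (Fin n) ℝ (E n) := (EuclideanSpace.basisFun (Fin n) ℝ).toBasis

lemma stdB_apply (i : Fin n) : stdB n i = EuclideanSpace.single i 1 := by
  simp [stdB]

lemma toMatrix_stdB (A : E n →ₗ[ℝ] E n) (i j : Fin n) :
    LinearMap.toMatrix (stdB n) (stdB n) A i j = A (EuclideanSpace.single j 1) i := by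
  rw [LinearMap.toMatrix_apply, stdB_apply]
  simp [stdB]

lemma firstForm_mul (u : E n → ℝ) (x : E n) (Q : Matrix (Fin n) (Fin n) ℝ) (i j : Fin n) :
    (firstForm u x * Q) i j = Q i j + gradient u x i * ∑ m, gradient u x m * Q m j := by
  simp [Matrix.mul_apply, firstForm, add_mul, Finset.sum_add_distrib, Finset.mul_sum, mul_assoc]

lemma isUnit_det_firstForm (u : E n → ℝ) (x : E n) : IsUnit (firstForm u x).det := by
  set p := gradient u x with hp
  refine Matrix.isUnit_det_of_right_inverse
    (B := Matrix.of fun i j => (if i = j then 1 else 0) - (wf p)⁻¹ ^ 2 * p i * p j) ?_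
  ext i j
  rw [firstForm_mul, ← hp]
  have h1 : ∑ m, p m * (Matrix.of fun i j => (if i = j then 1 else 0) -
      (wf p)⁻¹ ^ 2 * p i * p j : Matrix (Fin n) (Fin n) ℝ) m j =
        (wf p)⁻¹ ^ 2 * p j := by
    have h2 : ∑ m, p m ^ 2 = ‖p‖ ^ 2 := by
      rw [EuclideanSpace.norm_sq_eq]; simp
    have h3 : ∑ m, p m * (Matrix.of fun i j => (if i = j then 1 else 0) -
        (wf p)⁻¹ ^ 2 * p i * p j : Matrix (Fin n) (Fin n) ℝ) m j =
          p j - (wf p)⁻¹ ^ 2 * p j * ∑ m, p m ^ 2 := by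
      simp only [Matrix.of_apply, mul_sub, Finset.sum_sub_distrib, Finset.mul_sum]
      congr 1
      · simp
      · exact Finset.sum_congr rfl fun m _ => by ring
    rw [h3, h2]
    have h := wf_sq p
    have h0 := wf_pos p
    have h1 : ‖p‖ ^ 2 = wf p ^ 2 - 1 := by linarith
    rw [h1]
    field_simp
    ring
  rw [h1, Matrix.one_apply, Matrix.of_apply]
  ring

lemma inv_firstForm_mul_secondForm {u : E n → ℝ} {x : E n} (h : ContDiffAt ℝ 2 u x) :
    (firstForm u x)⁻¹ * secondForm u x =
      LinearMap.toMatrix (stdB n) (stdB n) (wein (gradient u x) (hessOp u x) : E n →ₗ[ℝ] E n) := by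
  set A := wein (gradient u x) (hessOp u x) with hA
  have h1 : firstForm u x * LinearMap.toMatrix (stdB n) (stdB n) (A : E n →ₗ[ℝ] E n) =
      secondForm u x := by
    ext i j
    rw [firstForm_mul]
    simp only [toMatrix_stdB, ContinuousLinearMap.coe_coe]
    have h2 : ∑ m, gradient u x m * A (EuclideanSpace.single j 1) m =
        ⟪gradient u x, A (EuclideanSpace.single j 1)⟫ := by
      generalize gradient u x = p
      simp [PiLp.inner_apply, mul_comm]
    have h3 := congrArg (fun v : E n => v i) (wein_add (gradient u x) (hessOp u x)
      (EuclideanSpace.single j 1))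
    simp only [PiLp.add_apply, PiLp.smul_apply, smul_eq_mul, ← hA] at h3
    rw [h2, mul_comm (gradient u x i), h3]
    have h4 : hessOp u x (EuclideanSpace.single j 1) i = D2 u x (EuclideanSpace.single i 1)
        (EuclideanSpace.single j 1) := by
      rw [D2_symm h, ← inner_hessOp h, EuclideanSpace.inner_single_right]
      simp
    rw [h4]
    simp [secondForm, hess, slopeW, wf]
  rw [← h1, ← mul_assoc, Matrix.nonsing_inv_mul _ (isUnit_det_firstForm u x), one_mul]

open Polynomial in
lemma charpoly_roots_of_eigenbasis {A : E n →ₗ[ℝ] E n} (c : Module.Basis (Fin n) ℝ (E n))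
    {κ : Fin n → ℝ} (hc : ∀ i, A (c i) = κ i • c i) :
    eigs (LinearMap.toMatrix (stdB n) (stdB n) A) = Finset.univ.val.map κ ∧
      (LinearMap.toMatrix (stdB n) (stdB n) A).trace = ∑ i, κ i := by
  have h : LinearMap.toMatrix c c A = Matrix.diagonal κ := by
    ext i j
    rw [LinearMap.toMatrix_apply, hc, map_smul, Matrix.diagonal_apply]
    simp only [Module.Basis.repr_self, Finsupp.smul_apply, Finsupp.single_apply, smul_eq_mul]
    rcases eq_or_ne i j with rfl | hij
    · simp
    · simp [hij, hij.symm]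
  constructor
  · rw [eigs, LinearMap.charpoly_toMatrix, ← LinearMap.charpoly_toMatrix A c, h,
      Matrix.charpoly_diagonal]
    have := Polynomial.roots_multiset_prod_X_sub_C (Finset.univ.val.map κ)
    rwa [Multiset.map_map] at this
  · rw [← LinearMap.trace_eq_matrix_trace, LinearMap.trace_eq_matrix_trace ℝ c, h,
      Matrix.trace_diagonal]

/-- The curvatures of a graph, read off from an eigenbasis of the shape operator. -/
theorem curvatures_of_eigenbasis {u : E n → ℝ} {x : E n} (h : ContDiffAt ℝ 2 u x)
    (c : Module.Basis (Fin n) ℝ (E n)) {κ : Fin n → ℝ}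
    (hc : ∀ i, wein (gradient u x) (hessOp u x) (c i) = κ i • c i) :
    principalCurv u x = Finset.univ.val.map κ ∧ meanCurv u x = ∑ i, κ i ∧
      etaEigs u x = Finset.univ.val.map (lam κ) := by
  set A := wein (gradient u x) (hessOp u x) with hA
  obtain ⟨h1, h2⟩ := charpoly_roots_of_eigenbasis (A := (A : E n →ₗ[ℝ] E n)) c hc
  have hH : meanCurv u x = ∑ i, κ i := by
    rw [meanCurv, inv_firstForm_mul_secondForm h, ← hA, h2]
  refine ⟨by rw [principalCurv, inv_firstForm_mul_secondForm h, ← hA, h1], hH, ?_⟩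
  have h3 : (firstForm u x)⁻¹ * etaForm u x = LinearMap.toMatrix (stdB n) (stdB n)
      ((∑ i, κ i) • LinearMap.id - (A : E n →ₗ[ℝ] E n)) := by
    rw [etaForm, mul_sub, Matrix.mul_smul, Matrix.nonsing_inv_mul _ (isUnit_det_firstForm u x),
      inv_firstForm_mul_secondForm h, ← hA, map_sub, map_smul, LinearMap.toMatrix_id, hH]
  rw [etaEigs, h3]
  refine (charpoly_roots_of_eigenbasis c fun i => ?_).1
  simp only [LinearMap.sub_apply, LinearMap.smul_apply, LinearMap.id_apply,
    ContinuousLinearMap.coe_coe, hc, lam, sub_smul]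

/-- The symmetric square root `S` of the inverse first fundamental form. Conjugation by `S` makes the
shape operator symmetric, with coefficients that are smooth in the gradient. -/
def sqrtG (p : E n) (ξ : E n) : E n := ξ - ((wf p)⁻¹ ^ 2 / (1 + (wf p)⁻¹) * ⟪p, ξ⟫) • p

lemma sqrtG_sqrtG (p : E n) (ξ : E n) :
    sqrtG p (sqrtG p ξ) = ξ - ((wf p)⁻¹ ^ 2 * ⟪p, ξ⟫) • p := by
  unfold sqrtG
  set c := (wf p)⁻¹ ^ 2 / (1 + (wf p)⁻¹) with hc
  rw [inner_sub_right, inner_smul_right, real_inner_self_eq_norm_sq, sub_sub, ← add_smul]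
  congr 2
  have h := wf_sq p
  have h0 := wf_pos p
  have h1 : ‖p‖ ^ 2 = wf p ^ 2 - 1 := by linarith
  rw [h1, hc]
  field_simp
  ring

lemma inner_sqrtG_left (p ξ ζ : E n) : ⟪sqrtG p ξ, ζ⟫ = ⟪ξ, sqrtG p ζ⟫ := by
  unfold sqrtG
  rw [inner_sub_left, inner_sub_right, inner_smul_left, inner_smul_right, real_inner_comm p ξ]
  simp
  ring

/-- `S` as a linear map. -/
def sqrtGL (p : E n) : E n →ₗ[ℝ] E n where
  toFun := sqrtG p
  map_add' ξ ζ := by simp only [sqrtG, inner_add_right, mul_add, add_smul]; abel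
  map_smul' t ξ := by
    simp only [sqrtG, inner_smul_right, smul_sub, smul_smul, RingHom.id_apply]
    congr 2; ring

lemma norm_sqrtG_sq (p ξ : E n) : ‖sqrtG p ξ‖ ^ 2 = ‖ξ‖ ^ 2 - (wf p)⁻¹ ^ 2 * ⟪p, ξ⟫ ^ 2 := by
  rw [← real_inner_self_eq_norm_sq, inner_sqrtG_left, sqrtG_sqrtG, inner_sub_right,
    inner_smul_right, real_inner_self_eq_norm_sq, real_inner_comm p ξ]
  ring

lemma norm_sqrtG_le (p ξ : E n) : ‖sqrtG p ξ‖ ≤ ‖ξ‖ := by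
  have := norm_sqrtG_sq p ξ
  refine abs_le_of_sq_le_sq' ?_ (norm_nonneg _) |>.2
  nlinarith [mul_nonneg (sq_nonneg (wf p)⁻¹) (sq_nonneg ⟪p, ξ⟫)]

/-- `S` is bounded below, as `g ≤ w²`. -/
lemma norm_le_sqrtG (p ξ : E n) : ‖ξ‖ ≤ wf p * ‖sqrtG p ξ‖ := by
  have h := norm_sqrtG_sq p ξ
  have h0 := wf_pos p
  have hw := wf_sq p
  refine abs_le_of_sq_le_sq' ?_ (by positivity) |>.2
  have h1 : ⟪p, ξ⟫ ^ 2 ≤ (‖p‖ * ‖ξ‖) ^ 2 := by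
    rw [← sq_abs]; exact pow_le_pow_left₀ (abs_nonneg _) (abs_real_inner_le_norm p ξ) 2
  have h2 : (wf p * ‖sqrtG p ξ‖) ^ 2 = wf p ^ 2 * ‖ξ‖ ^ 2 - ⟪p, ξ⟫ ^ 2 := by
    rw [mul_pow, h]
    field_simp
  rw [h2, hw]
  nlinarith

lemma sqrtG_injective (p : E n) : Function.Injective (sqrtGL p) := by
  rw [← LinearMap.ker_eq_bot, LinearMap.ker_eq_bot']
  intro ξ hξ
  have := norm_le_sqrtG p ξ
  rw [show sqrtG p ξ = 0 from hξ, norm_zero, mul_zero] at this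
  exact norm_le_zero_iff.1 this

/-- The symmetric operator `w⁻¹ S B S`, conjugate to the shape operator. -/
def symOp (p : E n) (B : E n →L[ℝ] E n) : E n →ₗ[ℝ] E n :=
  (wf p)⁻¹ • (sqrtGL p ∘ₗ (B : E n →ₗ[ℝ] E n) ∘ₗ sqrtGL p)

lemma symOp_apply (p : E n) (B : E n →L[ℝ] E n) (ξ : E n) :
    symOp p B ξ = (wf p)⁻¹ • sqrtG p (B (sqrtG p ξ)) := rfl

lemma inner_symOp (p : E n) (B : E n →L[ℝ] E n) (ξ ζ : E n) :
    ⟪symOp p B ξ, ζ⟫ = (wf p)⁻¹ * ⟪B (sqrtG p ξ), sqrtG p ζ⟫ := by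
  rw [symOp_apply, inner_smul_left, inner_sqrtG_left]; simp

lemma wein_sqrtG (p : E n) (B : E n →L[ℝ] E n) (ξ : E n) :
    wein p B (sqrtG p ξ) = sqrtG p (symOp p B ξ) := by
  have : sqrtG p (symOp p B ξ) = (wf p)⁻¹ • sqrtG p (sqrtG p (B (sqrtG p ξ))) :=
    (sqrtGL p).map_smul _ _
  rw [this, sqrtG_sqrtG, wein_apply]

lemma symOp_isSymmetric {p : E n} {B : E n →L[ℝ] E n} (hB : ∀ ξ ζ, ⟪B ξ, ζ⟫ = ⟪ξ, B ζ⟫) :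
    (symOp p B).IsSymmetric := by
  intro ξ ζ
  rw [inner_symOp, real_inner_comm (symOp p B ζ) ξ, inner_symOp, hB, real_inner_comm]

lemma finrank_E : Module.finrank ℝ (E n) = n := by simp

/-- An orthonormal eigenbasis of the symmetric form of the shape operator. -/
theorem exists_eigenbasis {p : E n} {B : E n →L[ℝ] E n} (hB : ∀ ξ ζ, ⟪B ξ, ζ⟫ = ⟪ξ, B ζ⟫) :
    ∃ (b : OrthonormalBasis (Fin n) ℝ (E n)) (κ : Fin n → ℝ), ∀ i, symOp p B (b i) = κ i • b i := by
  have h := symOp_isSymmetric (p := p) hB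
  exact ⟨h.eigenvectorBasis finrank_E, h.eigenvalues finrank_E, fun i => by
    exact h.apply_eigenvectorBasis finrank_E i⟩

/-- The curvatures of a graph whose shape operator is conjugate to `w⁻¹ S B S`, for `S` and `B`
possibly belonging to another graph. -/
theorem curvatures_of_conj {u : E n → ℝ} {x : E n} (h : ContDiffAt ℝ 2 u x) {p : E n}
    {B : E n →L[ℝ] E n} {L : E n →ₗ[ℝ] E n} (hL : Function.Injective L)
    (hconj : ∀ ξ, wein (gradient u x) (hessOp u x) (L ξ) = L (wein p B ξ))
    {b : OrthonormalBasis (Fin n) ℝ (E n)} {κ : Fin n → ℝ}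
    (hb : ∀ i, symOp p B (b i) = κ i • b i) :
    principalCurv u x = Finset.univ.val.map κ ∧ meanCurv u x = ∑ i, κ i ∧
      etaEigs u x = Finset.univ.val.map (lam κ) := by
  let e : E n ≃ₗ[ℝ] E n := LinearEquiv.ofInjectiveEndo (L ∘ₗ sqrtGL p)
    (hL.comp (sqrtG_injective p))
  refine curvatures_of_eigenbasis h (b.toBasis.map e) fun i => ?_
  have he : ∀ ξ, e ξ = L (sqrtG p ξ) := fun ξ => rfl
  rw [Module.Basis.map_apply, OrthonormalBasis.coe_toBasis, he, hconj, wein_sqrtG, hb]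
  have : sqrtG p (κ i • b i) = κ i • sqrtG p (b i) := (sqrtGL p).map_smul _ _
  rw [this, map_smul]

/-! ### Rotating the ambient space -/

/-- A vector of `ℝⁿ × ℝ`, as an element of the Euclidean space `ℝⁿ⁺¹`. -/
def mkV : (E n × ℝ) →L[ℝ] V n := (WithLp.prodContinuousLinearEquiv 2 ℝ (E n) ℝ).symm

/-- The two components of a vector of `ℝⁿ⁺¹`. -/
def unV : V n →L[ℝ] (E n × ℝ) := (WithLp.prodContinuousLinearEquiv 2 ℝ (E n) ℝ)

@[simp] lemma unV_mkV (q : E n × ℝ) : unV (mkV q) = q := rfl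

@[simp] lemma mkV_unV (q : V n) : mkV (unV q) = q := rfl

lemma mkV_injective : Function.Injective (mkV : E n × ℝ → V n) := fun a b h => by
  simpa using congrArg unV h

lemma inner_mkV (a b : E n × ℝ) : ⟪mkV a, mkV b⟫ = ⟪a.1, b.1⟫ + a.2 * b.2 := by
  rw [WithLp.prod_inner_apply]
  simp [mkV, mul_comm]

lemma norm_mkV_sq (a : E n × ℝ) : ‖mkV a‖ ^ 2 = ‖a.1‖ ^ 2 + a.2 ^ 2 := by
  rw [← real_inner_self_eq_norm_sq, inner_mkV, real_inner_self_eq_norm_sq, sq a.2]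

/-- The vertical unit vector. -/
def vert (n : ℕ) : V n := mkV (0, 1)

lemma norm_vert : ‖vert n‖ = 1 := by
  have : ‖vert n‖ ^ 2 = 1 := by rw [vert, norm_mkV_sq]; simp
  nlinarith [norm_nonneg (vert n)]

/-- The position vector `(x, u x)` of the graph. -/
def pos (u : E n → ℝ) (x : E n) : V n := mkV (x, u x)

/-- The tangent vector `(ξ, ⟪p, ξ⟫)` of a graph with gradient `p`. -/
def tang (p : E n) : E n →L[ℝ] V n := mkV.comp ((ContinuousLinearMap.id ℝ (E n)).prod (innerSL ℝ p))

lemma tang_apply (p ξ : E n) : tang p ξ = mkV (ξ, ⟪p, ξ⟫) := by simp [tang]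

lemma tang_injective (p : E n) : Function.Injective (tang p) := fun a b h => by
  rw [tang_apply, tang_apply] at h
  exact (Prod.ext_iff.1 (mkV_injective h)).1

/-- The upward unit normal as a function of the gradient. -/
def nrm (p : E n) : V n := (wf p)⁻¹ • mkV (-p, 1)

lemma normal_eq (u : E n → ℝ) (x : E n) : normal u x = nrm (gradient u x) := rfl

lemma norm_nrm (p : E n) : ‖nrm p‖ = 1 := by
  have h0 := wf_pos p
  have h : ‖nrm p‖ ^ 2 = 1 := by
    rw [nrm, norm_smul, mul_pow, norm_mkV_sq]
    simp only [norm_neg, one_pow, norm_inv, Real.norm_eq_abs, abs_of_pos h0]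
    rw [add_comm, ← wf_sq]
    field_simp
  nlinarith [norm_nonneg (nrm p)]

lemma inner_nrm_tang (p ξ : E n) : ⟪nrm p, tang p ξ⟫ = 0 := by
  rw [nrm, tang_apply, inner_smul_left, inner_mkV]
  simp

lemma inner_nrm_vert (p : E n) : ⟪nrm p, vert n⟫ = (wf p)⁻¹ := by
  rw [nrm, vert, inner_smul_left, inner_mkV]
  simp

@[simp] lemma nrm_zero : nrm (0 : E n) = vert n := by simp [nrm, vert]

lemma hasFDerivAt_pos {u : E n → ℝ} {x : E n} (h : DifferentiableAt ℝ u x) :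
    HasFDerivAt (pos u) (tang (gradient u x)) x := by
  have h1 : HasFDerivAt u (innerSL ℝ (gradient u x)) x := by
    have := h.hasFDerivAt
    refine this.congr_fderiv ?_
    ext ξ
    rw [innerSL_apply_apply, inner_gradient]
  exact mkV.hasFDerivAt.comp x ((hasFDerivAt_id x).prodMk h1)

lemma wf_contDiff {m : WithTop ℕ∞} : ContDiff ℝ m (wf : E n → ℝ) := by
  unfold wf
  refine ContDiff.sqrt ?_ fun p => by positivity
  exact contDiff_const.add (contDiff_norm_sq ℝ)

lemma hasFDerivAt_wf_inv (p : E n) :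
    HasFDerivAt (fun p : E n => (wf p)⁻¹) (-((wf p)⁻¹ ^ 3) • innerSL ℝ p) p := by
  have h0 := wf_pos p
  have h1 : HasFDerivAt (fun p : E n => 1 + ‖p‖ ^ 2) ((2 : ℝ) • innerSL ℝ p) p := by
    have := (hasStrictFDerivAt_norm_sq p).hasFDerivAt.const_add 1
    exact this.congr_fderiv (by ext; simp)
  have h2 : HasFDerivAt (wf : E n → ℝ) _ p := h1.sqrt (by positivity)
  have h3 := (hasDerivAt_inv h0.ne').comp_hasFDerivAt p h2
  refine h3.congr_fderiv ?_
  ext ξ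
  simp only [smul_apply, smul_eq_mul]
  change -(wf p ^ 2)⁻¹ * (1 / (2 * wf p) * (2 * _)) = _
  field_simp

/-- The Weingarten equation. -/
lemma hasFDerivAt_normal {u : E n → ℝ} {x : E n} (h : ContDiffAt ℝ 2 u x) :
    HasFDerivAt (normal u)
      (-((tang (gradient u x)).comp (wein (gradient u x) (hessOp u x)))) x := by
  have hg := hasFDerivAt_gradient h
  set p := gradient u x with hp
  set B := hessOp u x with hB
  have h1 : HasFDerivAt (fun y => (wf (gradient u y))⁻¹) _ x :=
    HasFDerivAt.comp (g := fun p : E n => (wf p)⁻¹) x (hasFDerivAt_wf_inv p) hg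
  have h2 : HasFDerivAt (fun y => mkV (-gradient u y, (1 : ℝ))) _ x :=
    mkV.hasFDerivAt.comp x (hg.neg.prodMk (hasFDerivAt_const (1 : ℝ) x))
  have h3 := h1.smul h2
  refine h3.congr_fderiv ?_
  ext1 ξ
  have h0 := wf_pos p
  simp only [add_apply, smul_apply,
    ContinuousLinearMap.smulRight_apply, ContinuousLinearMap.comp_apply,
    ContinuousLinearMap.prod_apply, neg_apply, innerSL_apply_apply,
    zero_apply, tang_apply, ← map_smul, ← map_add, ← map_neg, ← hp]
  congr 1
  refine Prod.ext ?_ ?_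
  · simp only [Prod.fst_add, Prod.smul_fst, Prod.fst_neg, wein_apply, inner_smul_left, map_neg,
      conj_trivial]
    generalize (wf p)⁻¹ = c
    module
  · simp only [Prod.snd_add, Prod.smul_snd, Prod.snd_neg, inner_wein, inner_smul_left, map_neg,
      conj_trivial]
    generalize (wf p)⁻¹ = c
    simp

/-- A linear isometry of `ℝⁿ⁺¹` that takes the vertical direction to a given unit vector. -/
lemma exists_isometry_vert {ν : V n} (hν : ‖ν‖ = 1) : ∃ Φ : V n ≃ₗᵢ[ℝ] V n, Φ (vert n) = ν :=
  ⟨(ℝ ∙ (vert n - ν))ᗮ.reflection, Submodule.reflection_sub (by rw [norm_vert, hν])⟩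

lemma eq_nrm_of_orthogonal {m : V n} {p : E n} (hm : ‖m‖ = 1) (ho : ∀ ζ, ⟪m, tang p ζ⟫ = 0)
    (hpos : 0 < ⟪m, vert n⟫) : m = nrm p := by
  obtain ⟨⟨a, c⟩, rfl⟩ : ∃ q, mkV q = m := ⟨unV m, by simp⟩
  rw [vert, inner_mkV] at hpos
  simp only [inner_zero_right, mul_one, zero_add] at hpos
  have h1 : a = -(c • p) := by
    refine ext_inner_right ℝ fun ζ => ?_
    have := ho ζ
    rw [tang_apply, inner_mkV] at this
    simp only at this
    rw [inner_neg_left, inner_smul_left]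
    simp only [conj_trivial]
    linarith
  have h2 : ‖mkV (a, c)‖ ^ 2 = 1 := by rw [hm, one_pow]
  rw [norm_mkV_sq, h1] at h2
  simp only [norm_neg, norm_smul, mul_pow, Real.norm_eq_abs, sq_abs] at h2
  have h3 : c ^ 2 * wf p ^ 2 = 1 := by rw [wf_sq]; linarith
  have h4 : c * wf p = 1 := by
    have := mul_pos hpos (wf_pos p)
    have h5 : (c * wf p) ^ 2 = 1 := by rw [mul_pow, h3]
    nlinarith
  have h5 : c = (wf p)⁻¹ := eq_inv_of_mul_eq_one_left h4
  rw [nrm, ← map_smul, h1, h5]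
  simp

/-- Near any of its points a graph is, up to a linear isometry `Φ` of the ambient space that takes the
vertical direction to the normal at that point, the graph of another function `v`. -/
theorem exists_rotated_param {u : E n → ℝ} {x₀ : E n} (h : ContDiffAt ℝ 4 u x₀) {Φ : V n ≃ₗᵢ[ℝ] V n}
    (hΦ : Φ (vert n) = nrm (gradient u x₀)) :
    ∃ (X : E n → E n) (v : E n → ℝ), X 0 = x₀ ∧ ContDiffAt ℝ 4 X 0 ∧ ContDiffAt ℝ 4 v 0 ∧
      ∀ᶠ y in 𝓝 0, pos u (X y) = pos u x₀ + Φ (pos v y) := by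
  have hdiff : DifferentiableAt ℝ u x₀ := h.differentiableAt (by norm_num)
  have hposC : ContDiffAt ℝ 4 (pos u) x₀ := mkV.contDiff.contDiffAt.comp x₀ (contDiffAt_id.prodMk h)
  -- `Y` is the projection of the graph to its tangent plane at `x₀`
  obtain ⟨Ψ, hΨa⟩ : ∃ Ψ : V n →L[ℝ] V n, ∀ q, Ψ q = Φ.symm q :=
    ⟨(Φ.symm.toContinuousLinearEquiv : V n →L[ℝ] V n), fun q => rfl⟩
  set Y : E n → E n := fun x => (unV (Ψ (pos u x - pos u x₀))).1 with hY
  have hYC : ContDiffAt ℝ 4 Y x₀ :=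
    (ContinuousLinearMap.fst ℝ (E n) ℝ).contDiff.contDiffAt.comp x₀
      (unV.contDiff.contDiffAt.comp x₀ (Ψ.contDiff.contDiffAt.comp x₀ (hposC.sub contDiffAt_const)))
  set Y' : E n →L[ℝ] E n := (ContinuousLinearMap.fst ℝ (E n) ℝ).comp
    (unV.comp (Ψ.comp (tang (gradient u x₀)))) with hY'
  have hYd : HasFDerivAt Y Y' x₀ :=
    (ContinuousLinearMap.fst ℝ (E n) ℝ).hasFDerivAt.comp x₀
      (unV.hasFDerivAt.comp x₀ (Ψ.hasFDerivAt.comp x₀ ((hasFDerivAt_pos hdiff).sub_const _)))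
  have hinj : Function.Injective Y' := by
    rw [injective_iff_map_eq_zero]
    intro ξ hξ
    have h1 : Ψ (tang (gradient u x₀) ξ) = (unV (Ψ (tang (gradient u x₀) ξ))).2 • vert n := by
      conv_lhs => rw [← mkV_unV (Ψ (tang (gradient u x₀) ξ))]
      rw [vert, ← map_smul]
      congr 1
      exact Prod.ext (by simpa [hY'] using hξ) (by simp)
    have h2 : ⟪vert n, Ψ (tang (gradient u x₀) ξ)⟫ = 0 := by
      rw [hΨa, ← Φ.inner_map_map, hΦ, Φ.apply_symm_apply, inner_nrm_tang]
    rw [h1, inner_smul_right, real_inner_self_eq_norm_sq, norm_vert] at h2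
    have h3 : Ψ (tang (gradient u x₀) ξ) = 0 := by
      rw [h1]
      simp only [one_pow, mul_one] at h2
      rw [h2, zero_smul]
    rw [hΨa] at h3
    have h4 : tang (gradient u x₀) ξ = 0 := by simpa using h3
    exact tang_injective _ (by rw [h4, map_zero])
  set Ye : E n ≃L[ℝ] E n :=
    (LinearEquiv.ofInjectiveEndo (Y' : E n →ₗ[ℝ] E n) hinj).toContinuousLinearEquiv
  have hYe : (Ye : E n →L[ℝ] E n) = Y' := by ext ξ; rfl
  have hYd' : HasFDerivAt Y (Ye : E n →L[ℝ] E n) x₀ := hYe ▸ hYd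
  have hY0 : Y x₀ = 0 := by simp [hY]
  have hYs : HasStrictFDerivAt Y (Ye : E n →L[ℝ] E n) x₀ := hYC.hasStrictFDerivAt' hYd' (by norm_num)
  obtain ⟨X, hX0, hXC, hXr⟩ : ∃ X : E n → E n, X 0 = x₀ ∧ ContDiffAt ℝ 4 X 0 ∧
      ∀ᶠ y in 𝓝 0, Y (X y) = y := by
    refine ⟨hYC.localInverse hYd' (by norm_num), ?_, ?_, ?_⟩
    · have := hYC.localInverse_apply_image hYd' (by norm_num)
      rwa [hY0] at this
    · have := hYC.to_localInverse hYd' (by norm_num)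
      rwa [hY0] at this
    · have := hYs.eventually_right_inverse
      rwa [hY0] at this
  have hposX : ContDiffAt ℝ 4 (fun y => pos u (X y)) 0 := by
    have : ContDiffAt ℝ 4 (pos u) (X 0) := hX0 ▸ hposC
    exact this.comp 0 hXC
  refine ⟨X, fun y => (unV (Ψ (pos u (X y) - pos u x₀))).2, hX0, hXC,
    (ContinuousLinearMap.snd ℝ (E n) ℝ).contDiff.contDiffAt.comp (0 : E n)
      (unV.contDiff.contDiffAt.comp (0 : E n)
        (Ψ.contDiff.contDiffAt.comp (0 : E n) (hposX.sub contDiffAt_const))), ?_⟩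
  filter_upwards [hXr] with y hy
  have h1 : pos (fun y => (unV (Ψ (pos u (X y) - pos u x₀))).2) y =
      Φ.symm (pos u (X y) - pos u x₀) := by
    rw [pos, ← hΨa, ← mkV_unV (Ψ _)]
    congr 1
    exact Prod.ext hy.symm rfl
  rw [h1, Φ.apply_symm_apply]
  abel

/-- Uniqueness of the derivative, applied to a vector. -/
lemma fderiv_apply_unique {E F : Type*} [NormedAddCommGroup E] [NormedSpace ℝ E]
    [NormedAddCommGroup F] [NormedSpace ℝ F] {f g : E → F} {f' g' : E →L[ℝ] F} {x : E}
    (hf : HasFDerivAt f f' x) (hg : HasFDerivAt g g' x) (h : f =ᶠ[𝓝 x] g) (ζ : E) :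
    f' ζ = g' ζ :=
  DFunLike.congr_fun (hf.unique (hg.congr_of_eventuallyEq h)) ζ

/-- The differential of the parametrization of a rotated graph. -/
lemma tang_of_rotated {u v : E n → ℝ} {X : E n → E n} {Φ : V n →L[ℝ] V n} {q : V n} {y : E n}
    (h : ∀ᶠ z in 𝓝 y, pos u (X z) = q + Φ (pos v z)) (hu : DifferentiableAt ℝ u (X y))
    (hv : DifferentiableAt ℝ v y) (hX : DifferentiableAt ℝ X y) (ζ : E n) :
    tang (gradient u (X y)) (fderiv ℝ X y ζ) = Φ (tang (gradient v y) ζ) := by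
  have h1 : HasFDerivAt (fun y => pos u (X y)) ((tang (gradient u (X y))).comp (fderiv ℝ X y)) y :=
    (hasFDerivAt_pos hu).comp y hX.hasFDerivAt
  have h2 : HasFDerivAt (fun y => q + Φ (pos v y)) (Φ.comp (tang (gradient v y))) y :=
    (Φ.hasFDerivAt.comp y (hasFDerivAt_pos hv)).const_add _
  exact fderiv_apply_unique h1 h2 h ζ

/-- If the normals of two graphs correspond under a linear map, then so do their derivatives, and by the
Weingarten equation the shape operators are conjugate. -/
lemma wein_of_rotated {u v : E n → ℝ} {X : E n → E n} {Φ : V n →L[ℝ] V n} {y : E n}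
    (h : ∀ᶠ z in 𝓝 y, normal u (X z) = Φ (normal v z)) (hu : ContDiffAt ℝ 2 u (X y))
    (hv : ContDiffAt ℝ 2 v y) (hX : DifferentiableAt ℝ X y)
    (ht : ∀ ζ, tang (gradient u (X y)) (fderiv ℝ X y ζ) = Φ (tang (gradient v y) ζ)) (ξ : E n) :
    wein (gradient u (X y)) (hessOp u (X y)) (fderiv ℝ X y ξ) =
      fderiv ℝ X y (wein (gradient v y) (hessOp v y) ξ) := by
  have h1 : HasFDerivAt (fun y => normal u (X y)) _ y :=
    (hasFDerivAt_normal hu).comp y hX.hasFDerivAt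
  have h2 : HasFDerivAt (fun y => Φ (normal v y)) _ y :=
    Φ.hasFDerivAt.comp y (hasFDerivAt_normal hv)
  have h3 := fderiv_apply_unique h1 h2 h ξ
  simp only [ContinuousLinearMap.comp_apply, neg_apply, map_neg, neg_inj] at h3
  rw [← ht] at h3
  exact tang_injective _ h3

lemma continuous_nrm : Continuous (nrm : E n → V n) := by
  unfold nrm
  refine Continuous.smul (wf_contDiff (m := 0) |>.continuous.inv₀ fun p => (wf_pos p).ne') ?_
  exact mkV.continuous.comp (continuous_neg.prodMk continuous_const)

/-- Near any of its points the graph of `u` is, up to a rigid motion with linear part `Φ`, the graph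
of a function `v` whose gradient vanishes at that point. The shape operators are conjugate. -/
theorem exists_rotated_graph {u : E n → ℝ} {x₀ : E n} (h : ContDiffAt ℝ 4 u x₀) :
    ∃ (Φ : V n ≃ₗᵢ[ℝ] V n) (X : E n → E n) (v : E n → ℝ), X 0 = x₀ ∧ ContinuousAt X 0 ∧
      ContDiffAt ℝ 4 v 0 ∧ gradient v 0 = 0 ∧
      ∀ᶠ y in 𝓝 0, pos u (X y) = pos u x₀ + Φ (pos v y) ∧ normal u (X y) = Φ (normal v y) ∧
        ∃ L : E n →ₗ[ℝ] E n, Function.Injective L ∧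
          ∀ ξ, wein (gradient u (X y)) (hessOp u (X y)) (L ξ) =
            L (wein (gradient v y) (hessOp v y) ξ) := by
  obtain ⟨Φ, hΦ⟩ := exists_isometry_vert (norm_nrm (gradient u x₀))
  obtain ⟨Φc, hΦc⟩ : ∃ Φc : V n →L[ℝ] V n, ∀ q, Φc q = Φ q :=
    ⟨(Φ.toContinuousLinearEquiv : V n →L[ℝ] V n), fun q => rfl⟩
  obtain ⟨X, v, hX0, hXC, hvC, hposev⟩ := exists_rotated_param h hΦ
  have hXev : ∀ᶠ y in 𝓝 0, ContDiffAt ℝ 4 X y := hXC.eventually (by norm_num)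
  have hvev : ∀ᶠ y in 𝓝 0, ContDiffAt ℝ 4 v y := hvC.eventually (by norm_num)
  have hXcont : Tendsto X (𝓝 0) (𝓝 x₀) := by
    have := hXC.continuousAt
    rwa [ContinuousAt, hX0] at this
  have huev : ∀ᶠ y in 𝓝 0, ContDiffAt ℝ 4 u (X y) :=
    hXcont.eventually (h.eventually (by norm_num))
  have hder : ∀ᶠ y in 𝓝 0, ∀ ζ, tang (gradient u (X y)) (fderiv ℝ X y ζ) =
      Φ (tang (gradient v y) ζ) := by
    filter_upwards [hposev.eventually_nhds, hXev, hvev, huev] with y hy hXy hvy huy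
    simp only [← hΦc] at hy ⊢
    exact tang_of_rotated hy (huy.differentiableAt (by norm_num)) (hvy.differentiableAt (by norm_num))
      (hXy.differentiableAt (by norm_num))
  have hDinj : ∀ᶠ y in 𝓝 0, Function.Injective (fderiv ℝ X y) := by
    filter_upwards [hder] with y hy a b hab
    have : Φ (tang (gradient v y) a) = Φ (tang (gradient v y) b) := by rw [← hy, ← hy, hab]
    exact tang_injective _ (Φ.injective this)
  have hgradc : ContinuousAt (fun y => gradient u (X y)) 0 := by
    have h1 : ContinuousAt (gradient u) (X 0) := by
      rw [hX0]; exact (contDiffAt_gradient (m := 3) h (by norm_num)).continuousAt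
    exact h1.comp hXC.continuousAt
  have hnrmc : ContinuousAt (fun y => ⟪Φ.symm (nrm (gradient u (X y))), vert n⟫) 0 := by
    have h2 : ContinuousAt (fun y => nrm (gradient u (X y))) 0 :=
      ContinuousAt.comp (g := nrm) continuous_nrm.continuousAt hgradc
    exact (ContinuousAt.comp (g := Φ.symm) Φ.symm.continuous.continuousAt h2).inner
      continuousAt_const
  have hnpos : ∀ᶠ y in 𝓝 0, 0 < ⟪Φ.symm (nrm (gradient u (X y))), vert n⟫ := by
    refine hnrmc.eventually (lt_mem_nhds ?_)
    beta_reduce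
    rw [hX0, ← hΦ, Φ.symm_apply_apply, real_inner_self_eq_norm_sq, norm_vert]
    norm_num
  have hnormal : ∀ᶠ y in 𝓝 0, normal u (X y) = Φ (normal v y) := by
    filter_upwards [hnpos, hder] with y hy hyd
    rw [normal_eq, normal_eq]
    have := eq_nrm_of_orthogonal (m := Φ.symm (nrm (gradient u (X y)))) (p := gradient v y)
      (by rw [Φ.symm.norm_map, norm_nrm]) (fun ζ => by
        rw [← Φ.inner_map_map, Φ.apply_symm_apply, ← hyd, inner_nrm_tang]) hy
    rw [← this, Φ.apply_symm_apply]
  have hgrad0 : gradient v 0 = 0 := by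
    refine ext_inner_right ℝ fun ζ => ?_
    have h1 := hder.self_of_nhds ζ
    have h2 : ⟪vert n, tang (gradient v 0) ζ⟫ = 0 := by
      rw [← Φ.inner_map_map, ← h1, hΦ, hX0, inner_nrm_tang]
    rw [vert, tang_apply, inner_mkV] at h2
    simpa only [inner_zero_left, zero_add, one_mul] using h2
  refine ⟨Φ, X, v, hX0, hXC.continuousAt, hvC, hgrad0, ?_⟩
  filter_upwards [hposev, hnormal.eventually_nhds, hder, hDinj, hXev, hvev, huev]
    with y hy1 hy2 hyd hyi hXy hvy huy
  have hy2' := hy2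
  have hyd' := hyd
  simp only [← hΦc] at hy2' hyd'
  exact ⟨hy1, hy2.self_of_nhds, (fderiv ℝ X y : E n →ₗ[ℝ] E n), hyi,
    wein_of_rotated hy2' (huy.of_le (by norm_num)) (hvy.of_le (by norm_num))
      (hXy.differentiableAt (by norm_num)) hyd'⟩

/-! ### Second-order jets of curves -/

section Jets

variable {F G H : Type*} [NormedAddCommGroup F] [NormedSpace ℝ F] [NormedAddCommGroup G]
  [NormedSpace ℝ G] [NormedAddCommGroup H] [NormedSpace ℝ H]

/-- The curve `f` is twice differentiable at `0`, with value `a`, velocity `b` and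
acceleration `c`. -/
def Jet2 (f : ℝ → F) (a b c : F) : Prop :=
  ∃ f' : ℝ → F, (∀ᶠ t in 𝓝 0, HasDerivAt f (f' t) t) ∧ f 0 = a ∧ f' 0 = b ∧ HasDerivAt f' c 0

lemma Jet2.hasDerivAt {f : ℝ → F} {a b c : F} (h : Jet2 f a b c) : HasDerivAt f b 0 := by
  obtain ⟨f', h1, -, rfl, -⟩ := h
  exact h1.self_of_nhds

lemma Jet2.eval {f : ℝ → F} {a b c : F} (h : Jet2 f a b c) : f 0 = a := h.choose_spec.2.1

lemma Jet2.values {f : ℝ → F} {a b c a' b' c' : F} (h : Jet2 f a b c) (ha : a = a') (hb : b = b')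
    (hc : c = c') : Jet2 f a' b' c' := by
  subst ha hb hc
  exact h

lemma Jet2.const (a : F) : Jet2 (fun _ => a) a 0 0 :=
  ⟨fun _ => 0, Eventually.of_forall fun t => hasDerivAt_const t a, rfl, rfl, hasDerivAt_const 0 0⟩

lemma Jet2.add {f g : ℝ → F} {a b c a' b' c' : F} (hf : Jet2 f a b c) (hg : Jet2 g a' b' c') :
    Jet2 (fun t => f t + g t) (a + a') (b + b') (c + c') := by
  obtain ⟨f', h1, rfl, rfl, h2⟩ := hf
  obtain ⟨g', h3, rfl, rfl, h4⟩ := hg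
  refine ⟨fun t => f' t + g' t, ?_, rfl, rfl, h2.add h4⟩
  filter_upwards [h1, h3] with t ht ht' using ht.add ht'

lemma Jet2.clm {f : ℝ → F} {a b c : F} (hf : Jet2 f a b c) (L : F →L[ℝ] G) :
    Jet2 (fun t => L (f t)) (L a) (L b) (L c) := by
  obtain ⟨f', h1, rfl, rfl, h2⟩ := hf
  refine ⟨fun t => L (f' t), ?_, rfl, rfl, L.hasFDerivAt.comp_hasDerivAt 0 h2⟩
  filter_upwards [h1] with t ht using L.hasFDerivAt.comp_hasDerivAt t ht

lemma Jet2.neg {f : ℝ → F} {a b c : F} (hf : Jet2 f a b c) :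
    Jet2 (fun t => -f t) (-a) (-b) (-c) := hf.clm (-ContinuousLinearMap.id ℝ F)

lemma Jet2.sub {f g : ℝ → F} {a b c a' b' c' : F} (hf : Jet2 f a b c) (hg : Jet2 g a' b' c') :
    Jet2 (fun t => f t - g t) (a - a') (b - b') (c - c') := by
  simpa only [sub_eq_add_neg] using hf.add hg.neg

lemma Jet2.sum {ι : Type*} (s : Finset ι) {f : ι → ℝ → F} {a b c : ι → F}
    (h : ∀ i ∈ s, Jet2 (f i) (a i) (b i) (c i)) :
    Jet2 (fun t => ∑ i ∈ s, f i t) (∑ i ∈ s, a i) (∑ i ∈ s, b i) (∑ i ∈ s, c i) := by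
  classical
  induction s using Finset.induction_on with
  | empty => simpa using Jet2.const (0 : F)
  | insert i s hi ih =>
    simp only [Finset.sum_insert hi]
    exact (h i (Finset.mem_insert_self i s)).add
      (ih fun j hj => h j (Finset.mem_insert_of_mem hj))

lemma Jet2.prodMk {f : ℝ → F} {g : ℝ → G} {a b c : F} {a' b' c' : G} (hf : Jet2 f a b c)
    (hg : Jet2 g a' b' c') : Jet2 (fun t => (f t, g t)) (a, a') (b, b') (c, c') := by
  obtain ⟨f', h1, rfl, rfl, h2⟩ := hf
  obtain ⟨g', h3, rfl, rfl, h4⟩ := hg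
  refine ⟨fun t => (f' t, g' t), ?_, rfl, rfl, h2.prodMk h4⟩
  filter_upwards [h1, h3] with t ht ht' using ht.prodMk ht'

lemma Jet2.bilin (L : F →L[ℝ] G →L[ℝ] H) {f : ℝ → F} {g : ℝ → G} {a b c : F} {a' b' c' : G}
    (hf : Jet2 f a b c) (hg : Jet2 g a' b' c') :
    Jet2 (fun t => L (f t) (g t)) (L a a') (L a b' + L b a')
      (L a c' + (2 : ℝ) • L b b' + L c a') := by
  obtain ⟨f', h1, rfl, rfl, h2⟩ := hf
  obtain ⟨g', h3, rfl, rfl, h4⟩ := hg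
  refine ⟨fun t => L (f t) (g' t) + L (f' t) (g t), ?_, rfl, rfl, ?_⟩
  · filter_upwards [h1, h3] with t ht ht'
    exact L.hasDerivAt_of_bilinear (fun _ => ht) fun _ => ht'
  · have := (L.hasDerivAt_of_bilinear (fun _ => h1.self_of_nhds) fun _ => h4).add
      (L.hasDerivAt_of_bilinear (fun _ => h2) fun _ => h3.self_of_nhds)
    refine this.congr_deriv ?_
    rw [two_smul]
    abel

lemma Jet2.mul {f g : ℝ → ℝ} {a b c a' b' c' : ℝ} (hf : Jet2 f a b c) (hg : Jet2 g a' b' c') :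
    Jet2 (fun t => f t * g t) (a * a') (a * b' + b * a') (a * c' + 2 * (b * b') + c * a') := by
  simpa using Jet2.bilin (ContinuousLinearMap.mul ℝ ℝ) hf hg

lemma Jet2.smul {f : ℝ → ℝ} {g : ℝ → F} {a b c : ℝ} {a' b' c' : F} (hf : Jet2 f a b c)
    (hg : Jet2 g a' b' c') : Jet2 (fun t => f t • g t) (a • a') (a • b' + b • a')
      (a • c' + (2 : ℝ) • (b • b') + c • a') := by
  simpa using Jet2.bilin (ContinuousLinearMap.lsmul ℝ ℝ) hf hg

lemma Jet2.clm_apply {f : ℝ → F →L[ℝ] G} {g : ℝ → F} {a b c : F →L[ℝ] G} {a' b' c' : F}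
    (hf : Jet2 f a b c) (hg : Jet2 g a' b' c') : Jet2 (fun t => f t (g t)) (a a') (a b' + b a')
      (a c' + (2 : ℝ) • (b b') + c a') := by
  simpa using Jet2.bilin (ContinuousLinearMap.id ℝ (F →L[ℝ] G)) hf hg

lemma Jet2.inner {F : Type*} [NormedAddCommGroup F] [InnerProductSpace ℝ F] {f g : ℝ → F}
    {a b c a' b' c' : F} (hf : Jet2 f a b c) (hg : Jet2 g a' b' c') :
    Jet2 (fun t => ⟪f t, g t⟫) ⟪a, a'⟫ (⟪a, b'⟫ + ⟪b, a'⟫) (⟪a, c'⟫ + 2 * ⟪b, b'⟫ + ⟪c, a'⟫) := by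
  have := Jet2.bilin (isBoundedBilinearMap_inner (𝕜 := ℝ) (E := F)).toContinuousLinearMap hf hg
  simpa using this

/-- The jet of a function along a straight line. -/
lemma Jet2.line {f : F → G} (hf : ContDiffAt ℝ 2 f 0) (b : F) :
    Jet2 (fun t : ℝ => f (t • b)) (f 0) (fderiv ℝ f 0 b) (fderiv ℝ (fderiv ℝ f) 0 b b) := by
  have hl : ∀ t : ℝ, HasDerivAt (fun t : ℝ => t • b) b t := fun t => by
    simpa using (hasDerivAt_id t).smul_const b
  have hl0 : Tendsto (fun t : ℝ => t • b) (𝓝 0) (𝓝 0) := by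
    have := (hl 0).continuousAt
    rwa [ContinuousAt, zero_smul] at this
  refine ⟨fun t => fderiv ℝ f (t • b) b, ?_, by simp, by simp, ?_⟩
  · filter_upwards [hl0.eventually (hf.eventually (by norm_num))] with t ht
    exact (ht.differentiableAt (by norm_num)).hasFDerivAt.comp_hasDerivAt t (hl t)
  · have h1 : HasFDerivAt (fderiv ℝ f) (fderiv ℝ (fderiv ℝ f) 0) ((0 : ℝ) • b) := by
      rw [zero_smul]
      exact ((hf.fderiv_right (m := 1) (by norm_num)).differentiableAt (by norm_num)).hasFDerivAt
    have h2 := h1.comp_hasDerivAt (0 : ℝ) (hl 0)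
    have h3 := h2.clm_apply (hasDerivAt_const (0 : ℝ) b)
    simpa using h3

lemma not_isLocalMax_of_deriv_pos {g g' : ℝ → ℝ} (hg : ∀ᶠ t in 𝓝 0, HasDerivAt g (g' t) t)
    (hpos : ∀ᶠ t in 𝓝[>] 0, 0 < g' t) : ¬ IsLocalMax g 0 := by
  intro hmax
  have h1 : ∀ᶠ t in 𝓝[≥] (0 : ℝ), HasDerivAt g (g' t) t ∧ g t ≤ g 0 :=
    nhdsWithin_le_nhds (hg.and hmax)
  obtain ⟨ε, hε, hε'⟩ := mem_nhdsGE_iff_exists_Icc_subset.1 h1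
  obtain ⟨ε₂, hε₂, hε₂'⟩ := mem_nhdsGT_iff_exists_Ioc_subset.1 hpos
  have hε0 : (0 : ℝ) < ε := hε
  have hε₂0 : (0 : ℝ) < ε₂ := hε₂
  set d := min ε ε₂ with hd
  have hd0 : 0 < d := lt_min hε0 hε₂0
  have hmono : StrictMonoOn g (Icc 0 d) := by
    refine strictMonoOn_of_deriv_pos (convex_Icc 0 d) (fun t ht => ?_) fun t ht => ?_
    · exact (hε' ⟨ht.1, ht.2.trans (min_le_left _ _)⟩).1.continuousAt.continuousWithinAt
    · rw [interior_Icc] at ht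
      rw [(hε' ⟨ht.1.le, ht.2.le.trans (min_le_left _ _)⟩).1.deriv]
      exact hε₂' ⟨ht.1, ht.2.le.trans (min_le_right _ _)⟩
  have h2 := hmono ⟨le_rfl, hd0.le⟩ ⟨hd0.le, le_rfl⟩ hd0
  have h3 := (hε' ⟨hd0.le, min_le_left _ _⟩).2
  linarith

/-- Let `f` have a derivative `D` which is Lipschitz along the curve `q`. If `f ∘ q` is touched at
`0` from above by a twice differentiable function, then this function bounds the formal second
derivative of `f ∘ q` up to the Lipschitz error, although `D` need not be differentiable. -/
theorem jet_le_of_touching {f : F → ℝ} {D : F → F →L[ℝ] ℝ} {q : ℝ → F} {q₀ q₁ q₂ : F}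
    (hq : Jet2 q q₀ q₁ q₂) {l : ℝ → ℝ} {l₀ l₁ l₂ : ℝ} (hl : Jet2 l l₀ l₁ l₂) {N : ℝ}
    (hD : ∀ᶠ t in 𝓝 0, HasFDerivAt f (D (q t)) (q t))
    (hN : ∀ᶠ t in 𝓝 0, ‖D (q t) - D q₀‖ ≤ N * ‖q t - q₀‖)
    (hle : ∀ᶠ t in 𝓝 0, f (q t) ≤ l t) (h0 : f (q 0) = l 0) :
    D q₀ q₁ = l₁ ∧ D q₀ q₂ - N * ‖q₁‖ ^ 2 ≤ l₂ := by
  obtain ⟨q', hq1, rfl, rfl, hq2⟩ := hq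
  obtain ⟨l', hl1, rfl, rfl, hl2⟩ := hl
  have hq0 := hq1.self_of_nhds
  set g : ℝ → ℝ := fun t => f (q t) - l t with hg
  have hgd : ∀ᶠ t in 𝓝 0, HasDerivAt g (D (q t) (q' t) - l' t) t := by
    filter_upwards [hD, hq1, hl1] with t h1 h2 h3
    exact (h1.comp_hasDerivAt t h2).sub h3
  have hmax : IsLocalMax g 0 := by
    filter_upwards [hle] with t ht
    simp only [hg]
    linarith
  have hfirst : D (q 0) (q' 0) - l' 0 = 0 := hmax.hasDerivAt_eq_zero hgd.self_of_nhds
  refine ⟨by linarith, ?_⟩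
  by_contra! hlt
  refine not_isLocalMax_of_deriv_pos hgd ?_ hmax
  have hs1 : Tendsto (fun t : ℝ => ‖t⁻¹ • (q t - q 0)‖) (𝓝[>] 0) (𝓝 ‖q' 0‖) := by
    have := (hasDerivAt_iff_tendsto_slope_zero.1 hq0)
    simp only [zero_add] at this
    exact (this.mono_left (nhdsWithin_mono _ fun t (ht : 0 < t) => ht.ne')).norm
  have hs2 : Tendsto (fun t : ℝ => ‖q' t‖) (𝓝[>] 0) (𝓝 ‖q' 0‖) :=
    (hq2.continuousAt.tendsto.mono_left nhdsWithin_le_nhds).norm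
  have hs3 : Tendsto (fun t : ℝ => t⁻¹ * (D (q 0) (q' t) - D (q 0) (q' 0)))
      (𝓝[>] 0) (𝓝 (D (q 0) q₂)) := by
    have := (hasDerivAt_iff_tendsto_slope_zero.1
      ((D (q 0)).hasFDerivAt.comp_hasDerivAt (0 : ℝ) hq2))
    simp only [zero_add, Function.comp] at this
    exact this.mono_left (nhdsWithin_mono _ fun t (ht : 0 < t) => ht.ne')
  have hs4 : Tendsto (fun t : ℝ => t⁻¹ * (l' t - l' 0)) (𝓝[>] 0) (𝓝 l₂) := by
    have := (hasDerivAt_iff_tendsto_slope_zero.1 hl2)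
    simp only [zero_add] at this
    exact this.mono_left (nhdsWithin_mono _ fun t (ht : 0 < t) => ht.ne')
  have hlim := ((hs3.sub ((hs1.mul hs2).const_mul N)).sub hs4)
  have hpos : 0 < D (q 0) q₂ - N * (‖q' 0‖ * ‖q' 0‖) - l₂ := by rw [← sq]; linarith
  filter_upwards [hlim.eventually (lt_mem_nhds hpos), nhdsWithin_le_nhds hN, self_mem_nhdsWithin]
    with t ht htN (ht0 : 0 < t)
  have h1 : D (q t) (q' t) - D (q 0) (q' t) ≥ -(N * ‖q t - q 0‖ * ‖q' t‖) := by
    have h2 : ‖(D (q t) - D (q 0)) (q' t)‖ ≤ N * ‖q t - q 0‖ * ‖q' t‖ :=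
      ((D (q t) - D (q 0)).le_opNorm _).trans (mul_le_mul_of_nonneg_right htN (norm_nonneg _))
    rw [sub_apply, Real.norm_eq_abs] at h2
    exact (abs_le.1 h2).1
  have h3 : 0 < t * (t⁻¹ * (D (q 0) (q' t) - D (q 0) (q' 0)) -
      N * (‖t⁻¹ • (q t - q 0)‖ * ‖q' t‖) - t⁻¹ * (l' t - l' 0)) := mul_pos ht0 ht
  rw [norm_smul, norm_inv, Real.norm_eq_abs, abs_of_pos ht0] at h3
  have h4 : t * (t⁻¹ * (D (q 0) (q' t) - D (q 0) (q' 0)) -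
      N * (t⁻¹ * ‖q t - q 0‖ * ‖q' t‖) - t⁻¹ * (l' t - l' 0)) =
      (D (q 0) (q' t) - D (q 0) (q' 0)) - N * ‖q t - q 0‖ * ‖q' t‖ - (l' t - l' 0) := by
    field_simp
  rw [h4] at h3
  linarith

lemma jet_nonneg_of_touching {l : ℝ → ℝ} {l₀ l₁ l₂ : ℝ} (hl : Jet2 l l₀ l₁ l₂)
    (hle : ∀ᶠ t in 𝓝 0, 0 ≤ l t) (h0 : l 0 = 0) : l₁ = 0 ∧ 0 ≤ l₂ := by
  have := jet_le_of_touching (f := fun _ : ℝ => (0 : ℝ)) (D := fun _ => 0) (N := 0)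
    (Jet2.const (0 : ℝ)) hl (Eventually.of_forall fun t => hasFDerivAt_const _ _)
    (by simp) hle h0.symm
  simp at this
  exact ⟨this.1.symm, this.2⟩

end Jets

/-! ### Symmetries of the third and fourth derivatives -/

lemma linear_fderiv_eq_of_eventually {F G H : Type*} [NormedAddCommGroup F] [NormedSpace ℝ F]
    [NormedAddCommGroup G] [NormedSpace ℝ G] [NormedAddCommGroup H] [NormedSpace ℝ H] {f : F → G}
    {x : F} (hf : DifferentiableAt ℝ f x) (L₁ L₂ : G →L[ℝ] H)
    (h : ∀ᶠ z in 𝓝 x, L₁ (f z) = L₂ (f z)) (c : F) :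
    L₁ (fderiv ℝ f x c) = L₂ (fderiv ℝ f x c) :=
  fderiv_apply_unique (L₁.hasFDerivAt.comp x hf.hasFDerivAt) (L₂.hasFDerivAt.comp x hf.hasFDerivAt)
    h c

/-- Evaluation of an operator at a vector. -/
def evalOp (ξ : E n) : (E n →L[ℝ] E n) →L[ℝ] E n := ContinuousLinearMap.apply ℝ (E n) ξ

/-- The functional `T ↦ ⟪T ξ, ζ⟫`. -/
def evalInner (ξ ζ : E n) : (E n →L[ℝ] E n) →L[ℝ] ℝ := (innerSL ℝ ζ).comp (evalOp ξ)

lemma evalInner_apply (ξ ζ : E n) (T : E n →L[ℝ] E n) : evalInner ξ ζ T = ⟪T ξ, ζ⟫ := by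
  simp [evalInner, evalOp, real_inner_comm]

lemma contDiffAt_hessOp {v : E n → ℝ} {y : E n} {m k : WithTop ℕ∞} (h : ContDiffAt ℝ k v y)
    (hm : m + 2 ≤ k) : ContDiffAt ℝ m (hessOp v) y :=
  (contDiffAt_gradient (m := m + 1) h (by rwa [add_assoc, one_add_one_eq_two])).fderiv_right le_rfl

lemma fderiv_hessOp_swap {v : E n → ℝ} {y : E n} (h : ContDiffAt ℝ 3 v y) (a ξ : E n) :
    fderiv ℝ (hessOp v) y a ξ = fderiv ℝ (hessOp v) y ξ a :=
  ((contDiffAt_gradient (m := 2) h (by norm_num)).isSymmSndFDerivAt (by simp)) a ξ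

lemma fderiv_hessOp_symm {v : E n → ℝ} {y : E n} (h : ContDiffAt ℝ 3 v y) (a ξ ζ : E n) :
    ⟪fderiv ℝ (hessOp v) y a ξ, ζ⟫ = ⟪fderiv ℝ (hessOp v) y a ζ, ξ⟫ := by
  have h1 := linear_fderiv_eq_of_eventually
    ((contDiffAt_hessOp (m := 1) h (by norm_num)).differentiableAt (by norm_num))
    (evalInner ξ ζ) (evalInner ζ ξ) ?_ a
  · simpa only [evalInner_apply] using h1
  · filter_upwards [h.eventually (by norm_num)] with z hz
    rw [evalInner_apply, evalInner_apply, hessOp_symm (hz.of_le (by norm_num)), real_inner_comm]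

/-- `v_{aaii} = v_{iiaa}`. -/
lemma fderiv_fderiv_hessOp_swap {v : E n → ℝ} (h : ContDiffAt ℝ 4 v 0) (a i : E n) :
    ⟪fderiv ℝ (fderiv ℝ (hessOp v)) 0 a a i, i⟫ = ⟪fderiv ℝ (fderiv ℝ (hessOp v)) 0 i i a, a⟫ := by
  have hB : ContDiffAt ℝ 2 (hessOp v) 0 := contDiffAt_hessOp h (by norm_num)
  have hd : DifferentiableAt ℝ (fderiv ℝ (hessOp v)) 0 :=
    (hB.fderiv_right (m := 1) (by norm_num)).differentiableAt (by norm_num)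
  have hev : ∀ᶠ z in 𝓝 (0 : E n), ContDiffAt ℝ 3 v z :=
    (h.eventually (by norm_num)).mono fun z hz => hz.of_le (by norm_num)
  set D := fderiv ℝ (fderiv ℝ (hessOp v)) 0 with hD
  have hg : ∀ a : E n, HasFDerivAt (fun z => fderiv ℝ (hessOp v) z a) (D.flip a) 0 := fun a =>
    (hd.hasFDerivAt.clm_apply (hasFDerivAt_const a 0)).congr_fderiv (by ext; simp [hD])
  have s1 : ∀ c a ξ : E n, D c a ξ = D c ξ a := fun c a ξ =>
    fderiv_apply_unique ((evalOp ξ).hasFDerivAt.comp 0 (hg a)) ((evalOp a).hasFDerivAt.comp 0 (hg ξ))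
      (hev.mono fun z hz => fderiv_hessOp_swap hz a ξ) c
  have s2 : ∀ c a ξ ζ : E n, ⟪D c a ξ, ζ⟫ = ⟪D c a ζ, ξ⟫ := by
    intro c a ξ ζ
    have h1 := fderiv_apply_unique ((evalInner ξ ζ).hasFDerivAt.comp 0 (hg a))
      ((evalInner ζ ξ).hasFDerivAt.comp 0 (hg a)) ?_ c
    · rw [ContinuousLinearMap.comp_apply, ContinuousLinearMap.comp_apply, evalInner_apply,
        evalInner_apply] at h1
      exact h1
    · filter_upwards [hev] with z hz
      simpa only [Function.comp_apply, evalInner_apply] using fderiv_hessOp_symm hz a ξ ζ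
  have s3 : ∀ c a : E n, D c a = D a c := fun c a => hB.isSymmSndFDerivAt (by simp) c a
  rw [s1 a a i, s3 a i, s2 i a a i, s1 i a i]

/-! ### Expansion of the curvatures at a point with horizontal tangent plane -/

lemma jet_wf_inv {p : ℝ → E n} {p₁ p₂ : E n} (hp : Jet2 p 0 p₁ p₂) :
    Jet2 (fun t => (wf (p t))⁻¹) 1 0 (-‖p₁‖ ^ 2) := by
  have hp0 := hp.hasDerivAt
  obtain ⟨p', h1, h2, h3, h4⟩ := hp
  refine ⟨fun t => -((wf (p t))⁻¹ ^ 3) * ⟪p t, p' t⟫, ?_, by simp [h2], by simp [h2], ?_⟩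
  · filter_upwards [h1] with t ht
    have := HasFDerivAt.comp_hasDerivAt t (hasFDerivAt_wf_inv (p t)) ht
    exact this.congr_deriv (by simp)
  · have h5 : HasDerivAt (fun t => (wf (p t))⁻¹) 0 0 := by
      have := HasFDerivAt.comp_hasDerivAt 0 (hasFDerivAt_wf_inv (p 0)) hp0
      exact this.congr_deriv (by simp [h2])
    have h6 := (h5.pow 3).neg.mul (hp0.inner ℝ h4)
    refine h6.congr_deriv ?_
    simp [h2, h3]

lemma jet_nrm {p : ℝ → E n} {p₁ p₂ : E n} (hp : Jet2 p 0 p₁ p₂) :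
    Jet2 (fun t => nrm (p t)) (vert n) (mkV (-p₁, 0)) (mkV (-p₂, -‖p₁‖ ^ 2)) := by
  have h := (jet_wf_inv hp).smul ((hp.neg.prodMk (Jet2.const (1 : ℝ))).clm mkV)
  refine h.values (by simp [vert]) (by simp) ?_
  rw [one_smul, zero_smul, smul_zero, add_zero, ← map_smul, ← map_add]
  simp

lemma exists_jet_of_contDiff {φ : E n → ℝ} (hφ : ContDiff ℝ 2 φ) {g : E n → E n}
    (hg : ContDiffAt ℝ 2 g 0) (b : E n) : ∃ c₁ c₂, Jet2 (fun t : ℝ => φ (g (t • b))) (φ (g 0)) c₁ c₂ :=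
  ⟨_, _, Jet2.line (f := fun y => φ (g y)) (hφ.contDiffAt.comp (0 : E n) hg) b⟩

/-- The expansion of a diagonal entry of the shape operator in a direction `f`, along a curve whose
gradient has velocity `κe • e`. The coefficient of the rank-one term in `sqrtG` matters only through
its value `1 / 2` at `p = 0`, as it multiplies a quantity of second order. -/
lemma jet_inner_symOp {p : ℝ → E n} {B : ℝ → E n →L[ℝ] E n} {B₀ B₁ B₂ : E n →L[ℝ] E n}
    {e f p₂ : E n} {κe κf d c₁ c₂ : ℝ} (hp : Jet2 p 0 (κe • e) p₂) (hB : Jet2 B B₀ B₁ B₂)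
    (hc : Jet2 (fun t => (wf (p t))⁻¹ ^ 2 / (1 + (wf (p t))⁻¹)) (1 / 2) c₁ c₂)
    (hf : B₀ f = κf • f) (hsymm : ∀ ξ ζ, ⟪B₀ ξ, ζ⟫ = ⟪ξ, B₀ ζ⟫)
    (he1 : ‖e‖ = 1) (hf1 : ‖f‖ = 1) (hd : ⟪e, f⟫ = d) :
    Jet2 (fun t => ⟪symOp (p t) (B t) f, f⟫) κf ⟪B₁ f, f⟫
      (⟪B₂ f, f⟫ - κe ^ 2 * κf - 2 * κf * κe ^ 2 * d ^ 2) := by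
  simp only [inner_symOp]
  have hs : Jet2 (fun t => sqrtG (p t) f) f 0 (-((κe ^ 2 * d) • e)) := by
    have h1 := (Jet2.const f).sub ((hc.mul (hp.inner (Jet2.const f))).smul hp)
    refine h1.values (by simp) (by simp) ?_
    · simp only [inner_smul_left, hd, inner_zero_left, inner_zero_right, smul_smul]
      simp only [conj_trivial, smul_zero, zero_sub, zero_add, mul_zero, add_zero]
      module
  have h2 := (jet_wf_inv hp).mul ((hB.clm_apply hs).inner hs)
  have hff : ⟪f, f⟫ = 1 := by rw [real_inner_self_eq_norm_sq, hf1, one_pow]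
  have h3 : ⟪B₀ e, f⟫ = κf * d := by rw [hsymm, hf, inner_smul_right, hd]
  refine h2.values ?_ ?_ ?_
  · rw [hf, inner_smul_left, hff]; simp
  · simp
  · simp only [hf, map_neg, map_smul, map_zero, inner_add_left, inner_neg_left, inner_neg_right,
      inner_smul_left, inner_smul_right, h3, hff, hd, norm_smul, he1, real_inner_comm e f]
    simp
    ring

/-! ### The equation in an orthonormal frame -/

lemma inner_apply_eq_sum {T : E n →ₗ[ℝ] E n} {b' : OrthonormalBasis (Fin n) ℝ (E n)}
    {κ' : Fin n → ℝ} (hb' : ∀ j, T (b' j) = κ' j • b' j) (e : E n) :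
    ⟪T e, e⟫ = ∑ j, ⟪b' j, e⟫ ^ 2 * κ' j := by
  conv_lhs => rw [← b'.sum_repr' e, map_sum, sum_inner]
  refine Finset.sum_congr rfl fun j _ => ?_
  rw [map_smul, hb', b'.sum_repr' e, inner_smul_left, inner_smul_left]
  simp only [conj_trivial]
  ring

lemma sum_inner_apply_eq {T : E n →ₗ[ℝ] E n} {b b' : OrthonormalBasis (Fin n) ℝ (E n)}
    {κ' : Fin n → ℝ} (hb' : ∀ j, T (b' j) = κ' j • b' j) :
    ∑ i, ⟪T (b i), b i⟫ = ∑ j, κ' j := by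
  simp only [inner_apply_eq_sum hb']
  rw [Finset.sum_comm]
  refine Finset.sum_congr rfl fun j _ => ?_
  rw [← Finset.sum_mul, b.sum_sq_inner_left, b'.norm_eq_one, one_pow, one_mul]

/-- The diagonal of a symmetric operator in an orthonormal basis is a doubly stochastic average of
its eigenvalues. Hence a supporting linear function of the curvature function, applied to the
diagonal, dominates the curvature function of the eigenvalues. -/
lemma Fcurv_le_diagonal {k l : ℕ} {N : Fin n → ℝ}
    (hN : ∀ κ', Cone k κ' → Fcurv k l κ' ≤ ∑ i, N i * κ' i) {T : E n →ₗ[ℝ] E n}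
    (b : OrthonormalBasis (Fin n) ℝ (E n)) {b' : OrthonormalBasis (Fin n) ℝ (E n)}
    {κ' : Fin n → ℝ} (hb' : ∀ j, T (b' j) = κ' j • b' j) (hκ' : Cone k κ') :
    Fcurv k l κ' ≤ ∑ i, N i * ⟪T (b i), b i⟫ := by
  have hP : (Matrix.of fun i j => ⟪b' j, b i⟫ ^ 2 : Matrix (Fin n) (Fin n) ℝ) ∈
      doublyStochastic ℝ (Fin n) := by
    rw [mem_doublyStochastic_iff_sum]
    refine ⟨fun i j => sq_nonneg _, fun i => ?_, fun j => ?_⟩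
    · simp only [Matrix.of_apply]
      rw [b'.sum_sq_inner_right, b.norm_eq_one, one_pow]
    · simp only [Matrix.of_apply]
      rw [b.sum_sq_inner_left, b'.norm_eq_one, one_pow]
  have := Fcurv_le_of_doublyStochastic hN hκ' hP
  simpa only [Matrix.of_apply, ← inner_apply_eq_sum hb'] using this

lemma cone_of_admissible {k : ℕ} {Ω : Set (E n)} {u : E n → ℝ} (h : IsAdmissible k Ω u) {x : E n}
    (hx : x ∈ Ω) {κ : Fin n → ℝ} (hκ : principalCurv u x = Finset.univ.val.map κ) : Cone k κ := by
  intro j hj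
  rcases Nat.eq_zero_or_pos j with rfl | hj0
  · simp
  · have h1 := h x hx j hj0 hj
    rw [hκ, Multiset.map_map] at h1
    rw [esig_eq_esymm]
    exact h1

lemma Fcurv_of_equation {k l : ℕ} {Ω : Set (E n)} {ψ : E n × ℝ × V n → ℝ} {u : E n → ℝ}
    (h : SolvesDirichlet k l Ω ψ u) {x : E n} (hx : x ∈ Ω) {κ : Fin n → ℝ}
    (hκ : etaEigs u x = Finset.univ.val.map (lam κ)) :
    Fcurv k l κ = ψ (x, u x, normal u x) ^ (1 / ((k : ℝ) - (l : ℝ))) := by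
  rw [← h.equation x hx, hκ, Fcurv, Fquot, esig_eq_esymm, esig_eq_esymm]

/-! ### Jets of the geometric quantities along the principal directions -/

/-- The jet of the `i`-th diagonal entry of the shape operator in the `a`-th principal direction. -/
lemma jet_principal {v : E n → ℝ} (hv : ContDiffAt ℝ 4 v 0) (hg : gradient v 0 = 0)
    {b : OrthonormalBasis (Fin n) ℝ (E n)} {κ : Fin n → ℝ}
    (hb : ∀ i, hessOp v 0 (b i) = κ i • b i) (a i : Fin n) :
    Jet2 (fun t : ℝ => ⟪symOp (gradient v (t • b a)) (hessOp v (t • b a)) (b i), b i⟫) (κ i)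
      ⟪fderiv ℝ (hessOp v) 0 (b a) (b i), b i⟫
      (⟪fderiv ℝ (fderiv ℝ (hessOp v)) 0 (b a) (b a) (b i), b i⟫ - κ a ^ 2 * κ i -
        2 * κ i * κ a ^ 2 * (if a = i then 1 else 0) ^ 2) := by
  have hG : ContDiffAt ℝ 2 (gradient v) 0 := contDiffAt_gradient hv (by norm_num)
  have hp := Jet2.line hG (b a)
  rw [hg] at hp
  have hp' := hp.values rfl (hb a) rfl
  have hc : ContDiff ℝ 2 fun p : E n => (wf p)⁻¹ ^ 2 / (1 + (wf p)⁻¹) := by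
    have h1 : ContDiff ℝ 2 fun p : E n => (wf p)⁻¹ := wf_contDiff.inv fun p => (wf_pos p).ne'
    exact (h1.pow 2).div (contDiff_const.add h1) fun p => by
      have := inv_pos.2 (wf_pos p)
      positivity
  obtain ⟨c₁, c₂, hc'⟩ := exists_jet_of_contDiff hc hG (b a)
  rw [hg] at hc'
  refine jet_inner_symOp hp' (Jet2.line (contDiffAt_hessOp hv (by norm_num)) (b a))
    (hc'.values (by norm_num) rfl rfl) (hb i) (hessOp_symm (hv.of_le (by norm_num)))
    (b.norm_eq_one a) (b.norm_eq_one i) ?_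
  exact b.inner_eq_ite a i

lemma jet_pos_line {v : E n → ℝ} (hv : ContDiffAt ℝ 4 v 0) (hg : gradient v 0 = 0)
    {b : OrthonormalBasis (Fin n) ℝ (E n)} {κ : Fin n → ℝ}
    (hb : ∀ i, hessOp v 0 (b i) = κ i • b i) (a : Fin n) :
    Jet2 (fun t : ℝ => pos v (t • b a)) (pos v 0) (mkV (b a, 0)) (mkV (0, κ a)) := by
  have hv2 : ContDiffAt ℝ 2 v 0 := hv.of_le (by norm_num)
  have h1 := ((Jet2.line (f := fun y : E n => y) contDiffAt_id (b a)).prodMk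
    (Jet2.line hv2 (b a))).clm mkV
  refine h1.values rfl ?_ ?_
  · rw [← inner_gradient, hg]
    simp
  · have h2 : fderiv ℝ (fderiv ℝ v) 0 (b a) (b a) = κ a := by
      change D2 v 0 (b a) (b a) = κ a
      rw [← inner_hessOp hv2, hb, inner_smul_left, b.inner_eq_ite]
      simp
    rw [h2]
    have h3 : fderiv ℝ (fderiv ℝ fun y : E n => y) 0 (b a) (b a) = 0 := by
      have : (fderiv ℝ fun y : E n => y) = fun _ => ContinuousLinearMap.id ℝ (E n) := by
        funext y; exact fderiv_fun_id
      rw [this]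
      simp
    rw [h3]

lemma jet_normal_line {v : E n → ℝ} (hv : ContDiffAt ℝ 4 v 0) (hg : gradient v 0 = 0)
    {b : OrthonormalBasis (Fin n) ℝ (E n)} {κ : Fin n → ℝ}
    (hb : ∀ i, hessOp v 0 (b i) = κ i • b i) (a : Fin n) :
    Jet2 (fun t : ℝ => normal v (t • b a)) (vert n) (mkV (-(κ a • b a), 0))
      (mkV (-fderiv ℝ (hessOp v) 0 (b a) (b a), -κ a ^ 2)) := by
  have hG : ContDiffAt ℝ 2 (gradient v) 0 := contDiffAt_gradient hv (by norm_num)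
  have hp := Jet2.line hG (b a)
  rw [hg] at hp
  refine (jet_nrm (hp.values rfl (hb a) rfl)).values rfl rfl ?_
  rw [norm_smul, b.norm_eq_one, mul_one, Real.norm_eq_abs, sq_abs]
  rfl

/-! ### The inequality at an interior maximum -/

/-- The summation behind the curvature estimate. The second derivative of the `i`-th diagonal entry of
the shape operator in the `j`-th principal direction has a part `Q j i` of fourth order, which is
symmetric in `j` and `i` and therefore cancels from the difference of `h3` and `h1` weighted by `N j`.
The third derivatives `T` enter only through `d₁`. -/
lemma sum_principal_ineq {T Q : Fin n → Fin n → ℝ} {N κ ε d₁ d₂ m : Fin n → ℝ} {e₀ φ a : ℝ}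
    (hQ : ∀ i j, Q i j = Q j i) (hN : ∀ i, 0 ≤ N i)
    (h1 : ∀ j, ∑ i, (Q j i - κ j ^ 2 * κ i - 2 * κ i * κ j ^ 2 * (if j = i then 1 else 0) ^ 2) ≤
      φ * (-∑ i, T i j * ε i - κ j ^ 2 * e₀))
    (h2 : ∀ i, d₁ i = ∑ j, N j * T i j)
    (h3 : ∀ j, d₂ j - m j ≤
      ∑ i, N i * (Q j i - κ j ^ 2 * κ i - 2 * κ i * κ j ^ 2 * (if j = i then 1 else 0) ^ 2))
    (hH : ∑ i, κ i = φ * (e₀ - a)) (hf : 0 ≤ ∑ i, N i * κ i) :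
    φ * a * ∑ i, N i * κ i ^ 2 ≤ -∑ j, d₂ j + ∑ j, m j - φ * ∑ i, ε i * d₁ i := by
  set R : Fin n → Fin n → ℝ := fun j i =>
    Q j i - κ j ^ 2 * κ i - 2 * κ i * κ j ^ 2 * (if j = i then 1 else 0) ^ 2 with hR
  have e1 : ∑ j, N j * ∑ i, R j i ≤ ∑ j, N j * (φ * (-∑ i, T i j * ε i - κ j ^ 2 * e₀)) :=
    Finset.sum_le_sum fun j _ => mul_le_mul_of_nonneg_left (h1 j) (hN j)
  have e2 : ∑ j, N j * (φ * (-∑ i, T i j * ε i - κ j ^ 2 * e₀)) =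
      -(φ * ∑ i, ε i * d₁ i) - φ * e₀ * ∑ i, N i * κ i ^ 2 := by
    have : ∑ i, ε i * d₁ i = ∑ j, N j * ∑ i, T i j * ε i := by
      simp only [h2, Finset.mul_sum]
      rw [Finset.sum_comm]
      exact Finset.sum_congr rfl fun j _ => Finset.sum_congr rfl fun i _ => by ring
    rw [this, Finset.mul_sum, Finset.mul_sum, ← Finset.sum_neg_distrib, ← Finset.sum_sub_distrib]
    exact Finset.sum_congr rfl fun j _ => by ring
  have e3 : ∑ j, d₂ j - ∑ j, m j ≤ ∑ j, ∑ i, N i * R j i := by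
    rw [← Finset.sum_sub_distrib]
    exact Finset.sum_le_sum fun j _ => h3 j
  have e4 : ∑ j, ∑ i, N i * R j i = ∑ j, N j * ∑ i, R j i +
      (∑ i, κ i) * ∑ i, N i * κ i ^ 2 - (∑ i, κ i ^ 2) * ∑ i, N i * κ i := by
    have hswap : ∑ j, ∑ i, N i * Q j i = ∑ j, ∑ i, N j * Q j i := by
      rw [Finset.sum_comm]
      exact Finset.sum_congr rfl fun j _ => Finset.sum_congr rfl fun i _ => by rw [hQ]
    have hdiag : ∀ j i, N i * (2 * κ i * κ j ^ 2 * (if j = i then (1 : ℝ) else 0) ^ 2) =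
        N j * (2 * κ i * κ j ^ 2 * (if j = i then (1 : ℝ) else 0) ^ 2) := by
      intro j i
      rcases eq_or_ne j i with rfl | h
      · rfl
      · simp [h]
    have t1 : (∑ i, κ i) * ∑ i, N i * κ i ^ 2 = ∑ j, ∑ i, N j * (κ j ^ 2 * κ i) := by
      rw [Finset.sum_mul_sum, Finset.sum_comm]
      exact Finset.sum_congr rfl fun j _ => Finset.sum_congr rfl fun i _ => by ring
    have t2 : (∑ i, κ i ^ 2) * ∑ i, N i * κ i = ∑ j, ∑ i, N i * (κ j ^ 2 * κ i) := by
      rw [Finset.sum_mul_sum]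
      exact Finset.sum_congr rfl fun j _ => Finset.sum_congr rfl fun i _ => by ring
    rw [t1, t2]
    simp only [hR, mul_sub, Finset.sum_sub_distrib, Finset.mul_sum]
    rw [hswap]
    simp only [hdiag]
    ring
  have e5 : 0 ≤ (∑ i, κ i ^ 2) * ∑ i, N i * κ i :=
    mul_nonneg (Finset.sum_nonneg fun i _ => sq_nonneg _) hf
  rw [hH] at e4
  nlinarith

/-- The elementary estimate that ends the argument: the cubic term wins. -/
lemma curvature_bound {κ : Fin n → ℝ} {H K c a φ N : ℝ} (hn : 0 < n) (hH : 0 < H) (hc : 0 < c)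
    (ha : 0 < a) (hN : 0 ≤ N) (hφ1 : H ≤ φ) (hφ2 : φ * a ≤ H)
    (hHκ : H = ∑ i, κ i) (hK : K = ∑ i, κ i ^ 2) (hKH : K ≤ ((n : ℝ) - 1) ^ 2 * H ^ 2)
    (hmain : φ * a * (c * K) ≤ N * (H + φ * ∑ i, |κ i| + K) + N * ∑ i, (1 + |κ i|) ^ 2 +
      φ * (N * ∑ i, (1 + |κ i|))) :
    H ≤ 1 + n / (a * c) * (N * (1 + n ^ 2 / a + n ^ 2 + n * (1 + n) ^ 2 + n * (1 + n) / a)) := by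
  have hn1 : (1 : ℝ) ≤ n := by exact_mod_cast hn
  set A := N * (1 + n ^ 2 / a + n ^ 2 + n * (1 + n) ^ 2 + n * (1 + n) / a) with hA
  have hA0 : 0 ≤ A := by positivity
  rcases le_or_gt H 1 with h1 | h1
  · have : 0 ≤ n / (a * c) * A := by positivity
    linarith
  have hKn : H ^ 2 ≤ n * K := by
    have := sq_sum_le_card_mul_sum_sq (s := Finset.univ) (f := κ)
    rw [Finset.card_univ, Fintype.card_fin, ← hHκ, ← hK] at this
    exact this
  have hKn2 : K ≤ n ^ 2 * H ^ 2 := by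
    refine hKH.trans (mul_le_mul_of_nonneg_right ?_ (sq_nonneg H))
    nlinarith
  have hκ : ∀ i, |κ i| ≤ n * H := by
    intro i
    have h2 : κ i ^ 2 ≤ K := by
      rw [hK]
      exact Finset.single_le_sum (f := fun i => κ i ^ 2) (fun j _ => sq_nonneg _)
        (Finset.mem_univ i)
    refine abs_le_of_sq_le_sq ?_ (by positivity)
    nlinarith
  have hs1 : ∑ i, |κ i| ≤ n * (n * H) := by
    have := Finset.sum_le_sum (s := Finset.univ) fun i _ => hκ i
    simpa using this
  have hb : ∀ i, 1 + |κ i| ≤ (1 + n) * H := fun i => by nlinarith [hκ i]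
  have hs2 : ∑ i, (1 + |κ i|) ≤ n * ((1 + n) * H) := by
    have := Finset.sum_le_sum (s := Finset.univ) fun i _ => hb i
    simpa using this
  have hs3 : ∑ i, (1 + |κ i|) ^ 2 ≤ n * ((1 + n) * H) ^ 2 := by
    have := Finset.sum_le_sum (s := Finset.univ) fun i _ =>
      pow_le_pow_left₀ (by positivity) (hb i) 2
    simpa using this
  have hφ : φ ≤ H / a := by rwa [le_div_iff₀ ha]
  have hφ0 : 0 < φ := hH.trans_le hφ1
  have r1 : φ * ∑ i, |κ i| ≤ H / a * (n * (n * H)) :=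
    mul_le_mul hφ hs1 (Finset.sum_nonneg fun i _ => abs_nonneg _) (by positivity)
  have r2 : φ * (N * ∑ i, (1 + |κ i|)) ≤ H / a * (N * (n * ((1 + n) * H))) :=
    mul_le_mul hφ (mul_le_mul_of_nonneg_left hs2 hN)
      (mul_nonneg hN (Finset.sum_nonneg fun i _ => by positivity)) (by positivity)
  have hup : φ * a * (c * K) ≤ A * H ^ 2 := by
    have r3 : N * (H + φ * ∑ i, |κ i| + K) ≤
        N * (H ^ 2 + H / a * (n * (n * H)) + n ^ 2 * H ^ 2) :=
      mul_le_mul_of_nonneg_left (by nlinarith) hN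
    have r4 : N * ∑ i, (1 + |κ i|) ^ 2 ≤ N * (n * ((1 + n) * H) ^ 2) :=
      mul_le_mul_of_nonneg_left hs3 hN
    have r5 : N * (H ^ 2 + H / a * (n * (n * H)) + n ^ 2 * H ^ 2) + N * (n * ((1 + n) * H) ^ 2) +
        H / a * (N * (n * ((1 + n) * H))) = A * H ^ 2 := by rw [hA]; ring
    linarith
  have hlow : H * a * (c * (H ^ 2 / n)) ≤ φ * a * (c * K) := by
    have : H ^ 2 / n ≤ K := by rw [div_le_iff₀ (by positivity)]; linarith
    gcongr
  have h3 : H * (a * c / n) ≤ A := by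
    have h4 : H * (a * c / n) * H ^ 2 ≤ A * H ^ 2 := by
      calc _ = H * a * (c * (H ^ 2 / n)) := by ring
        _ ≤ _ := hlow.trans hup
    exact le_of_mul_le_mul_right h4 (by positivity)
  have h5 : H ≤ n / (a * c) * A := by
    rw [div_mul_eq_mul_div, le_div_iff₀ (by positivity)]
    have : H * (a * c) = n * (H * (a * c / n)) := by field_simp
    rw [this]
    exact mul_le_mul_of_nonneg_left h3 (by positivity)
  linarith

/-! ### The touching conditions at a maximum -/

lemma norm_mkV_le (a : E n) (c : ℝ) : ‖mkV (a, c)‖ ≤ ‖a‖ + |c| := by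
  have h := norm_mkV_sq (a, c)
  refine abs_le_of_sq_le_sq' ?_ (by positivity) |>.2
  rw [h]
  nlinarith [sq_abs c, mul_nonneg (norm_nonneg a) (abs_nonneg c)]

/-- The diagonal entry of the shape operator of the graph of `v` in the direction `e`. -/
def diagEntry (v : E n → ℝ) (e y : E n) : ℝ := ⟪symOp (gradient v y) (hessOp v y) e, e⟫

/-- The curvature inequality at the origin for a graph with horizontal tangent plane there, under the
two touching conditions: the mean curvature is touched from above by a multiple of `⟪ν, e⟫ - a`, and
the right-hand side of the equation by a linear function of the diagonal of the shape operator. -/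
theorem touching_inequality {G : Type*} [NormedAddCommGroup G] [NormedSpace ℝ G] {v : E n → ℝ}
    (hv : ContDiffAt ℝ 4 v 0) (hg : gradient v 0 = 0) {b : OrthonormalBasis (Fin n) ℝ (E n)}
    {κ N : Fin n → ℝ} (hb : ∀ i, hessOp v 0 (b i) = κ i • b i) {e : V n} (he : ‖e‖ = 1)
    {φ a C : ℝ} (hφ : 0 ≤ φ) (hC : 0 ≤ C) (hN : ∀ i, 0 ≤ N i) (hH0 : 0 ≤ ∑ i, κ i)
    (hmax : ∀ᶠ y in 𝓝 0, ∑ i, diagEntry v (b i) y ≤ φ * (⟪normal v y, e⟫ - a))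
    (hmax0 : ∑ i, κ i = φ * (⟪vert n, e⟫ - a)) {J : V n × V n →L[ℝ] G}
    (hJ : ∀ Z m, ‖J (Z, m)‖ ≤ ‖Z‖ + ‖m‖) {g₀ : G} {f : G → ℝ} {D : G → G →L[ℝ] ℝ}
    (hD : ∀ᶠ y in 𝓝 0, HasFDerivAt f (D (J (pos v y, normal v y) + g₀))
      (J (pos v y, normal v y) + g₀))
    (hLip : ∀ᶠ y in 𝓝 0, ‖D (J (pos v y, normal v y) + g₀) - D (J (pos v 0, normal v 0) + g₀)‖ ≤
      C * ‖J (pos v y, normal v y) + g₀ - (J (pos v 0, normal v 0) + g₀)‖)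
    (hbd : ‖D (J (pos v 0, normal v 0) + g₀)‖ ≤ C)
    (hle : ∀ᶠ y in 𝓝 0, f (J (pos v y, normal v y) + g₀) ≤ ∑ i, N i * diagEntry v (b i) y)
    (hle0 : f (J (pos v 0, normal v 0) + g₀) = ∑ i, N i * κ i) (hf0 : 0 ≤ ∑ i, N i * κ i) :
    φ * a * ∑ i, N i * κ i ^ 2 ≤ C * (∑ i, κ i + φ * ∑ i, |κ i| + ∑ i, κ i ^ 2) +
      C * ∑ i, (1 + |κ i|) ^ 2 + φ * (C * ∑ i, (1 + |κ i|)) := by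
  have hv3 : ContDiffAt ℝ 3 v 0 := hv.of_le (by norm_num)
  set T : Fin n → Fin n → ℝ := fun i j => ⟪fderiv ℝ (hessOp v) 0 (b i) (b j), b j⟫ with hT
  set Q : Fin n → Fin n → ℝ := fun j i =>
    ⟪fderiv ℝ (fderiv ℝ (hessOp v)) 0 (b j) (b j) (b i), b i⟫ with hQ
  set P : Fin n → E n := fun j => fderiv ℝ (hessOp v) 0 (b j) (b j) with hP
  set q₁ : Fin n → G := fun j => J (mkV (b j, 0), mkV (-(κ j • b j), 0)) with hq₁
  set q₂ : Fin n → G := fun j => J (mkV (0, κ j), mkV (-P j, -κ j ^ 2)) with hq₂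
  set D₀ : G →L[ℝ] ℝ := D (J (pos v 0, normal v 0) + g₀) with hD₀
  obtain ⟨⟨ε, e₀⟩, rfl⟩ : ∃ p, mkV p = e := ⟨unV e, by simp⟩
  have hve : ⟪vert n, mkV (ε, e₀)⟫ = e₀ := by rw [vert, inner_mkV]; simp
  rw [hve] at hmax0
  have hε : ∀ i, |⟪b i, ε⟫| ≤ 1 := by
    intro i
    have h1 := abs_real_inner_le_norm (b i) ε
    rw [b.norm_eq_one, one_mul] at h1
    refine h1.trans ?_
    have h2 := norm_mkV_sq (ε, e₀)
    rw [he] at h2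
    nlinarith [norm_nonneg ε, sq_nonneg e₀]
  have hPT : ∀ i j, ⟪b i, P j⟫ = T i j := by
    intro i j
    rw [hP, hT, real_inner_comm]
    change ⟪fderiv ℝ (hessOp v) 0 (b j) (b j), b i⟫ = ⟪fderiv ℝ (hessOp v) 0 (b i) (b j), b j⟫
    rw [fderiv_hessOp_symm hv3, fderiv_hessOp_swap hv3]
  have hline : ∀ j, Tendsto (fun t : ℝ => t • b j) (𝓝 0) (𝓝 0) := by
    intro j
    have : ContinuousAt (fun t : ℝ => t • b j) 0 := by fun_prop
    rwa [ContinuousAt, zero_smul] at this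
  have hd0 : ∀ i, diagEntry v (b i) 0 = κ i := by
    intro i
    have := (jet_principal hv hg hb i i).eval
    simpa [diagEntry] using this
  have hnv0 : normal v 0 = vert n := by rw [normal_eq, hg, nrm_zero]
  -- the mean curvature is touched from above
  have hA : ∀ j, ∑ i, T j i = -(φ * (κ j * ⟪b j, ε⟫)) ∧
      ∑ i, (Q j i - κ j ^ 2 * κ i - 2 * κ i * κ j ^ 2 * (if j = i then 1 else 0) ^ 2) ≤
        φ * (-∑ i, T i j * ⟪b i, ε⟫ - κ j ^ 2 * e₀) := by
    intro j
    have h1 := Jet2.sum Finset.univ fun i _ => jet_principal hv hg hb j i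
    have h2 := (Jet2.const φ).mul (((jet_normal_line hv hg hb j).inner
      (Jet2.const (mkV (ε, e₀)))).sub (Jet2.const a))
    obtain ⟨h3, h4⟩ := jet_nonneg_of_touching (h2.sub h1) (by
      filter_upwards [(hline j).eventually hmax] with t ht
      exact sub_nonneg.2 ht) (by
        simp only [zero_smul, hnv0, hve]
        have : ∑ i, ⟪symOp (gradient v 0) (hessOp v 0) (b i), b i⟫ = ∑ i, κ i :=
          Finset.sum_congr rfl fun i _ => hd0 i
        rw [this, hmax0, sub_self])
    simp only [inner_mkV, inner_zero_right, zero_mul, sub_zero, add_zero, zero_add, mul_zero,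
      inner_neg_left, inner_smul_left, conj_trivial] at h3 h4
    have hPε : ⟪P j, ε⟫ = ∑ i, T i j * ⟪b i, ε⟫ := by
      rw [← b.sum_inner_mul_inner (P j) ε]
      refine Finset.sum_congr rfl fun i _ => ?_
      rw [real_inner_comm, hPT]
    constructor
    · have h5 : ∑ i, T j i = ∑ i, ⟪fderiv ℝ (hessOp v) 0 (b j) (b i), b i⟫ := rfl
      rw [h5]
      linarith
    · rw [← hPε]
      have h5 : ∑ i, (Q j i - κ j ^ 2 * κ i - 2 * κ i * κ j ^ 2 * (if j = i then 1 else 0) ^ 2) =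
          ∑ i, (⟪fderiv ℝ (fderiv ℝ (hessOp v)) 0 (b j) (b j) (b i), b i⟫ - κ j ^ 2 * κ i -
            2 * κ i * κ j ^ 2 * (if j = i then 1 else 0) ^ 2) := rfl
      rw [h5]
      have h6 : ⟪P j, ε⟫ = ⟪fderiv ℝ (hessOp v) 0 (b j) (b j), ε⟫ := rfl
      rw [h6]
      linarith
  -- the right-hand side of the equation is touched from above
  have hB : ∀ j, D₀ (q₁ j) = ∑ i, N i * T j i ∧ D₀ (q₂ j) - C * ‖q₁ j‖ ^ 2 ≤
      ∑ i, N i * (Q j i - κ j ^ 2 * κ i - 2 * κ i * κ j ^ 2 * (if j = i then 1 else 0) ^ 2) := by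
    intro j
    have h1 := Jet2.sum Finset.univ fun i _ => (Jet2.const (N i)).mul (jet_principal hv hg hb j i)
    have h2 := (((jet_pos_line hv hg hb j).prodMk (jet_normal_line hv hg hb j)).clm J).add
      (Jet2.const g₀)
    have h2' := h2.values (by rw [← hnv0]) (add_zero _) (add_zero _)
    have h1' := h1.values rfl (b' := ∑ i, N i * T j i)
      (Finset.sum_congr rfl fun i _ => by simp [hT])
      (c' := ∑ i, N i * (Q j i - κ j ^ 2 * κ i - 2 * κ i * κ j ^ 2 * (if j = i then 1 else 0) ^ 2))
      (Finset.sum_congr rfl fun i _ => by simp [hQ])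
    refine jet_le_of_touching h2' h1' ((hline j).eventually hD) ((hline j).eventually hLip)
      ((hline j).eventually hle) ?_
    simp only [zero_smul]
    rw [hle0]
    exact Finset.sum_congr rfl fun i _ => by rw [← hd0 i]; rfl
  have hsum := sum_principal_ineq (T := T) (Q := Q) (N := N) (κ := κ) (ε := fun i => ⟪b i, ε⟫)
    (d₁ := fun i => D₀ (q₁ i)) (d₂ := fun j => D₀ (q₂ j)) (m := fun j => C * ‖q₁ j‖ ^ 2) (e₀ := e₀)
    (φ := φ) (a := a) (fun i j => (fderiv_fderiv_hessOp_swap hv (b i) (b j))) hN (fun j => (hA j).2)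
    (fun i => (hB i).1) (fun j => (hB j).2) hmax0 hf0
  have hq1n : ∀ j, ‖q₁ j‖ ≤ 1 + |κ j| := by
    intro j
    refine (hJ _ _).trans ((add_le_add (norm_mkV_le _ _) (norm_mkV_le _ _)).trans ?_)
    rw [norm_neg, norm_smul, b.norm_eq_one, Real.norm_eq_abs]
    simp
  have hDq1 : ∀ j, |D₀ (q₁ j)| ≤ C * (1 + |κ j|) := fun j =>
    (D₀.le_opNorm _).trans (mul_le_mul hbd (hq1n j) (norm_nonneg _) hC)
  have e1 : -(φ * ∑ i, ⟪b i, ε⟫ * D₀ (q₁ i)) ≤ φ * (C * ∑ i, (1 + |κ i|)) := by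
    rw [← mul_neg]
    refine mul_le_mul_of_nonneg_left ?_ hφ
    rw [← Finset.sum_neg_distrib, Finset.mul_sum]
    refine Finset.sum_le_sum fun i _ => (neg_le_abs _).trans ?_
    rw [abs_mul]
    exact (mul_le_of_le_one_left (abs_nonneg _) (hε i)).trans (hDq1 i)
  have e2 : ∑ j, C * ‖q₁ j‖ ^ 2 ≤ C * ∑ i, (1 + |κ i|) ^ 2 := by
    rw [Finset.mul_sum]
    exact Finset.sum_le_sum fun i _ => mul_le_mul_of_nonneg_left
      (pow_le_pow_left₀ (norm_nonneg _) (hq1n i) 2) hC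
  have hPsum : ‖∑ j, P j‖ ≤ φ * ∑ i, |κ i| := by
    rw [← b.sum_repr' (∑ j, P j), Finset.mul_sum]
    refine norm_sum_le_of_le _ fun i _ => ?_
    rw [norm_smul, b.norm_eq_one, mul_one, inner_sum]
    simp only [hPT]
    rw [(hA i).1, norm_neg, norm_mul, Real.norm_of_nonneg hφ, norm_mul]
    refine mul_le_mul_of_nonneg_left ?_ hφ
    exact mul_le_of_le_one_right (norm_nonneg _) (hε i)
  have hq2sum : ∑ j, q₂ j = J (mkV (0, ∑ j, κ j), mkV (-∑ j, P j, -∑ j, κ j ^ 2)) := by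
    rw [hq₂, ← map_sum]
    congr 1
    refine Prod.ext ?_ ?_
    · rw [Prod.fst_sum, ← map_sum]
      congr 1
      refine Prod.ext ?_ ?_ <;> simp [Prod.fst_sum, Prod.snd_sum]
    · rw [Prod.snd_sum, ← map_sum]
      congr 1
      refine Prod.ext ?_ ?_ <;> simp [Prod.fst_sum, Prod.snd_sum]
  have e3 : -∑ j, D₀ (q₂ j) ≤ C * (∑ i, κ i + φ * ∑ i, |κ i| + ∑ i, κ i ^ 2) := by
    rw [← map_sum]
    refine (neg_le_abs _).trans ((D₀.le_opNorm _).trans (mul_le_mul hbd ?_ (norm_nonneg _) hC))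
    rw [hq2sum]
    refine (hJ _ _).trans ((add_le_add (norm_mkV_le _ _) (norm_mkV_le _ _)).trans ?_)
    rw [norm_neg, norm_zero, abs_neg, abs_of_nonneg hH0,
      abs_of_nonneg (Finset.sum_nonneg fun i _ => sq_nonneg (κ i))]
    linarith
  linarith

/-! ### The estimate at an interior maximum -/

lemma norm_le_of_c11Norm_le {Ω : Set (E n)} {R : ℝ} {f : E n × ℝ × V n → ℝ} {N : ℝ≥0}
    (h : c11Norm Ω R f ≤ N) {q : E n × ℝ × V n} (hq : q ∈ Ω ×ˢ Icc (-R) R ×ˢ Metric.sphere 0 1) :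
    ‖fderiv ℝ (radialExt f) q‖ ≤ N := by
  have h1 : ‖fderiv ℝ (radialExt f) q‖ₑ ≤ N :=
    (le_iSup₂ (f := fun q _ => ‖fderiv ℝ (radialExt f) q‖ₑ) q hq).trans
      ((le_add_left le_rfl).trans ((le_add_right le_rfl).trans h))
  rwa [enorm_le_coe] at h1

lemma norm_sub_le_of_c11Norm_le {Ω : Set (E n)} {R : ℝ} {f : E n × ℝ × V n → ℝ} {N : ℝ≥0}
    (h : c11Norm Ω R f ≤ N) {q q' : E n × ℝ × V n}
    (hq : q ∈ Ω ×ˢ Icc (-R) R ×ˢ Metric.sphere 0 1)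
    (hq' : q' ∈ Ω ×ˢ Icc (-R) R ×ˢ Metric.sphere 0 1) :
    ‖fderiv ℝ (radialExt f) q - fderiv ℝ (radialExt f) q'‖ ≤ N * ‖q - q'‖ := by
  rcases eq_or_ne q q' with rfl | hne
  · simp
  have h1 : edist (fderiv ℝ (radialExt f) q) (fderiv ℝ (radialExt f) q') / edist q q' ≤ N :=
    ((le_iSup₂ (f := fun q' _ => edist (fderiv ℝ (radialExt f) q) (fderiv ℝ (radialExt f) q') /
      edist q q') q' hq').trans (le_iSup₂ (f := fun q _ => ⨆ q' ∈
        Ω ×ˢ Icc (-R) R ×ˢ Metric.sphere 0 1, edist (fderiv ℝ (radialExt f) q)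
          (fderiv ℝ (radialExt f) q') / edist q q') q hq)).trans ((le_add_left le_rfl).trans h)
  rw [ENNReal.div_le_iff (edist_pos.2 hne).ne' (edist_ne_top _ _), edist_nndist, edist_nndist] at h1
  have h2 : nndist (fderiv ℝ (radialExt f) q) (fderiv ℝ (radialExt f) q') ≤ N * nndist q q' := by
    exact_mod_cast h1
  rw [← dist_eq_norm, ← dist_eq_norm, ← coe_nndist, ← coe_nndist]
  exact_mod_cast h2

lemma radialExt_of_norm {f : E n × ℝ × V n → ℝ} {q : E n × ℝ × V n} (h : ‖q.2.2‖ = 1) :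
    radialExt f q = f q := by
  rw [radialExt, h, inv_one, one_smul]

/-- The point `(x, z, ν)` at which the right-hand side is evaluated, as a linear function of the
position vector `(x, z)` and the normal `ν`. -/
def arg : V n × V n →L[ℝ] E n × ℝ × V n :=
  ((ContinuousLinearMap.fst ℝ (E n) ℝ).comp (unV.comp (ContinuousLinearMap.fst ℝ (V n) (V n)))).prod
    (((ContinuousLinearMap.snd ℝ (E n) ℝ).comp
      (unV.comp (ContinuousLinearMap.fst ℝ (V n) (V n)))).prod (ContinuousLinearMap.snd ℝ (V n) (V n)))

lemma arg_apply (Z m : V n) : arg (Z, m) = ((unV Z).1, (unV Z).2, m) := rfl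

lemma norm_arg_le (Z m : V n) : ‖arg (Z, m)‖ ≤ ‖Z‖ + ‖m‖ := by
  obtain ⟨⟨a, c⟩, rfl⟩ : ∃ q, mkV q = Z := ⟨unV Z, by simp⟩
  have h := norm_mkV_sq (a, c)
  simp only at h
  rw [arg_apply, unV_mkV]
  have h0 := norm_nonneg (mkV (a, c))
  have h1 : ‖a‖ ≤ ‖mkV (a, c)‖ := abs_le_of_sq_le_sq' (by rw [h]; nlinarith) h0 |>.2
  have h2 : |c| ≤ ‖mkV (a, c)‖ := abs_le_of_sq_le_sq' (by rw [h, sq_abs]; nlinarith [sq_nonneg ‖a‖]) h0 |>.2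
  have h3 := norm_nonneg m
  refine norm_prod_le_iff.2 ⟨by linarith, norm_prod_le_iff.2 ⟨?_, by linarith⟩⟩
  rw [Real.norm_eq_abs]; linarith

lemma symOp_zero (B : E n →L[ℝ] E n) (ξ : E n) : symOp 0 B ξ = B ξ := by
  have h : ∀ ζ : E n, sqrtG 0 ζ = ζ := fun ζ => by simp [sqrtG]
  refine ext_inner_right ℝ fun ζ => ?_
  rw [inner_symOp, h, h, wf_zero, inv_one, one_mul]

/-- At an interior point where the mean curvature is touched from above by a multiple of `W - a`,
with `W` the vertical component of the normal, it is bounded. -/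
theorem meanCurv_le_of_touching {k l : ℕ} (hk : 2 ≤ k) (hlk : l < k) (hkn : k < n) {c : ℝ} (hc : 0 < c)
    (hsup : ∀ κ : Fin n → ℝ, Cone k κ → ∃ N : Fin n → ℝ, (∀ i, c ≤ N i) ∧
      (∀ κ', Cone k κ' → Fcurv k l κ' ≤ ∑ i, N i * κ' i) ∧ ∑ i, N i * κ i = Fcurv k l κ)
    {Ω : Set (E n)} {ψ : E n × ℝ × V n → ℝ} {u : E n → ℝ} {M : ℝ} {N : ℝ≥0} (hΩ : IsOpen Ω)
    (hψ : IsC11 Ω fun q => ψ q ^ (1 / ((k : ℝ) - (l : ℝ))))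
    (hψN : c11Norm Ω M (fun q => ψ q ^ (1 / ((k : ℝ) - (l : ℝ)))) ≤ N)
    (hu : ContDiffOn ℝ 4 u Ω) (huM : ∀ x ∈ Ω, |u x| ≤ M) (hadm : IsAdmissible k Ω u)
    (hsol : SolvesDirichlet k l Ω ψ u) {x₀ : E n} (hx₀ : x₀ ∈ Ω) {φ a : ℝ} (ha : 0 < a)
    (haW : 2 * a ≤ (wf (gradient u x₀))⁻¹)
    (hmax : ∀ᶠ x in 𝓝 x₀, meanCurv u x ≤ φ * ((wf (gradient u x))⁻¹ - a))
    (hmax0 : meanCurv u x₀ = φ * ((wf (gradient u x₀))⁻¹ - a)) :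
    meanCurv u x₀ ≤
      1 + n / (a * c) * (N * (1 + n ^ 2 / a + n ^ 2 + n * (1 + n) ^ 2 + n * (1 + n) / a)) := by
  have hn : 2 ≤ n := by omega
  have hu4 : ∀ x ∈ Ω, ContDiffAt ℝ 4 u x := fun x hx => hu.contDiffAt (hΩ.mem_nhds hx)
  obtain ⟨Φ, X, v, hX0, hXc, hv, hg, hev⟩ := exists_rotated_graph (hu4 x₀ hx₀)
  obtain ⟨Φc, hΦc⟩ : ∃ Φc : V n →L[ℝ] V n, ∀ q, Φc q = Φ q :=
    ⟨(Φ.toContinuousLinearEquiv : V n →L[ℝ] V n), fun q => rfl⟩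
  have hXt : Tendsto X (𝓝 0) (𝓝 x₀) := by rwa [ContinuousAt, hX0] at hXc
  have hXΩ : ∀ᶠ y in 𝓝 0, X y ∈ Ω := hXt.eventually (hΩ.mem_nhds hx₀)
  have hv2 : ∀ᶠ y in 𝓝 0, ContDiffAt ℝ 2 v y :=
    (hv.eventually (by norm_num)).mono fun y hy => hy.of_le (by norm_num)
  -- principal curvatures at `x₀`, read off from the rotated graph at the origin
  obtain ⟨b, κ, hbs⟩ := exists_eigenbasis (p := gradient v 0) (hessOp_symm (hv2.self_of_nhds))
  have hb : ∀ i, hessOp v 0 (b i) = κ i • b i := fun i => by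
    rw [← hbs i, hg, symOp_zero]
  obtain ⟨hpos0, hnor0, L, hL, hconj⟩ := hev.self_of_nhds
  rw [hX0] at hpos0 hnor0 hconj
  obtain ⟨hκ1, hκ2, hκ3⟩ := curvatures_of_conj ((hu4 x₀ hx₀).of_le (by norm_num)) hL hconj hbs
  have hcone : Cone k κ := cone_of_admissible hadm hx₀ hκ1
  obtain ⟨Nf, hNc, hNle, hNeq⟩ := hsup κ hcone
  obtain ⟨hHpos, hKH⟩ := hcone.sum_pos_and_sq_le hk hn
  have hN0 : ∀ i, 0 ≤ Nf i := fun i => hc.le.trans (hNc i)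
  have hW1 : (wf (gradient u x₀))⁻¹ ≤ 1 := inv_le_one_of_one_le₀ (one_le_wf _)
  have hWa : 0 < (wf (gradient u x₀))⁻¹ - a := by linarith
  have hφ : 0 < φ := by
    rw [← hκ2, hmax0] at hHpos
    exact (pos_iff_pos_of_mul_pos hHpos).2 hWa
  -- the argument `(x, u x, ν)` of the right-hand side is affine in the jet of the rotated graph
  set F : E n × ℝ × V n → ℝ := fun q => ψ q ^ (1 / ((k : ℝ) - (l : ℝ))) with hF
  set J : V n × V n →L[ℝ] E n × ℝ × V n :=
    arg.comp ((Φc.comp (.fst ℝ (V n) (V n))).prod (Φc.comp (.snd ℝ (V n) (V n)))) with hJdef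
  have hJ : ∀ Z m, ‖J (Z, m)‖ ≤ ‖Z‖ + ‖m‖ := fun Z m => by
    have := norm_arg_le (Φ Z) (Φ m)
    rw [Φ.norm_map, Φ.norm_map, ← hΦc, ← hΦc] at this
    exact this
  set g₀ : E n × ℝ × V n := arg (pos u x₀, 0) with hg₀
  have hq : ∀ᶠ y in 𝓝 0, J (pos v y, normal v y) + g₀ = (X y, u (X y), normal u (X y)) := by
    filter_upwards [hev] with y hy
    have h1 : J (pos v y, normal v y) = arg (Φ (pos v y), Φ (normal v y)) := by
      rw [← hΦc, ← hΦc]; rfl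
    rw [h1, hg₀, ← map_add, ← hy.2.1, Prod.mk_add_mk, add_comm (Φ (pos v y)), ← hy.1, add_zero]
    rfl
  have hS : ∀ x ∈ Ω, (x, u x, normal u x) ∈ Ω ×ˢ Icc (-M) M ×ˢ Metric.sphere (0 : V n) 1 :=
    fun x hx => ⟨hx, abs_le.1 (huM x hx), by
      rw [mem_sphere_zero_iff_norm]; exact norm_nrm (gradient u x)⟩
  have hext : ∀ x ∈ Ω, radialExt F (x, u x, normal u x) = F (x, u x, normal u x) :=
    fun x _ => radialExt_of_norm (norm_nrm (gradient u x))
  have hq0 := hq.self_of_nhds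
  rw [hX0] at hq0
  have hWn : ∀ x, (wf (gradient u x))⁻¹ = ⟪normal u x, vert n⟫ := fun x => (inner_nrm_vert _).symm
  have hin : ∀ m, ⟪Φ m, vert n⟫ = ⟪m, Φ.symm (vert n)⟫ := fun m => by
    rw [← Φ.inner_map_map m, Φ.apply_symm_apply]
  have hdiag : ∀ᶠ y in 𝓝 0, ∃ (b' : OrthonormalBasis (Fin n) ℝ (E n)) (κ' : Fin n → ℝ),
      (∀ i, symOp (gradient v y) (hessOp v y) (b' i) = κ' i • b' i) ∧ Cone k κ' ∧
      meanCurv u (X y) = ∑ i, κ' i ∧ Fcurv k l κ' = F (X y, u (X y), normal u (X y)) := by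
    filter_upwards [hev, hv2, hXΩ] with y hy hvy hXy
    obtain ⟨b', κ', hb'⟩ := exists_eigenbasis (p := gradient v y) (hessOp_symm hvy)
    obtain ⟨_, _, L, hL, hconj⟩ := hy
    obtain ⟨h1, h2, h3⟩ := curvatures_of_conj ((hu4 _ hXy).of_le (by norm_num)) hL hconj hb'
    exact ⟨b', κ', hb', cone_of_admissible hadm hXy h1, h2, Fcurv_of_equation hsol hXy h3⟩
  have key := touching_inequality hv hg hb (e := Φ.symm (vert n))
    (by rw [Φ.symm.norm_map, norm_vert]) hφ.le N.2 hN0 hHpos.le (a := a)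
    (by
      filter_upwards [hdiag, hev, hXt.eventually hmax] with y ⟨b', κ', hb', _, h2, _⟩ hy hm
      have h3 : ∑ i, diagEntry v (b i) y = ∑ i, κ' i := sum_inner_apply_eq hb'
      rw [h3, ← h2, ← hin, ← hy.2.1, ← hWn]
      exact hm)
    (by
      rw [← hκ2, hmax0, hWn, hnor0, hin, normal_eq, hg, nrm_zero])
    hJ (g₀ := g₀) (f := radialExt F) (D := fderiv ℝ (radialExt F))
    (by
      filter_upwards [hq, hXΩ] with y hy hXy
      rw [hy]
      exact (hψ.differentiable _ ⟨hXy, mem_univ _, (hS _ hXy).2.2⟩).hasFDerivAt)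
    (by
      filter_upwards [hq, hXΩ] with y hy hXy
      rw [hy, hq0]
      exact norm_sub_le_of_c11Norm_le hψN (hS _ hXy) (hS _ hx₀))
    (by
      rw [hq0]
      exact norm_le_of_c11Norm_le hψN (hS _ hx₀))
    (by
      filter_upwards [hq, hXΩ, hdiag] with y hy hXy ⟨b', κ', hb', h1, _, h3⟩
      rw [hy, hext _ hXy, ← h3]
      exact Fcurv_le_diagonal hNle b hb' h1)
    (by
      rw [hq0, hext _ hx₀, hNeq]
      exact (Fcurv_of_equation hsol hx₀ hκ3).symm)
    (by
      rw [hNeq]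
      exact Real.rpow_nonneg (div_nonneg (hcone k le_rfl).le (hcone l hlk.le).le) _)
  refine curvature_bound (κ := κ) (K := ∑ i, κ i ^ 2) (φ := φ) (by omega) (hκ2 ▸ hHpos) hc ha N.2
    ?_ ?_ hκ2 rfl (hκ2 ▸ hKH) ?_
  · rw [hmax0]; nlinarith
  · rw [hmax0]; nlinarith
  · rw [hκ2]
    refine le_trans ?_ key
    refine mul_le_mul_of_nonneg_left ?_ (by positivity)
    rw [Finset.mul_sum]
    exact Finset.sum_le_sum fun i _ => mul_le_mul_of_nonneg_right (hNc i) (sq_nonneg _)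

/-! ### Second derivatives and mean curvature up to the boundary -/

/-- The mean curvature as a function of the gradient and the second derivative. -/
def trCurv (p : E n) (U : E n →L[ℝ] E n →L[ℝ] ℝ) : ℝ :=
  ∑ i, (wf p)⁻¹ * U (sqrtG p (EuclideanSpace.single i 1)) (sqrtG p (EuclideanSpace.single i 1))

lemma meanCurv_eq_trCurv {u : E n → ℝ} {x : E n} (h : ContDiffAt ℝ 2 u x) :
    meanCurv u x = trCurv (gradient u x) (D2 u x) := by
  obtain ⟨b, κ, hb⟩ := exists_eigenbasis (p := gradient u x) (hessOp_symm h)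
  obtain ⟨-, h2, -⟩ := curvatures_of_conj h (L := LinearMap.id) Function.injective_id
    (fun ξ => rfl) hb
  rw [h2, ← sum_inner_apply_eq (b := EuclideanSpace.basisFun (Fin n) ℝ) hb, trCurv]
  refine Finset.sum_congr rfl fun i _ => ?_
  rw [inner_symOp, inner_hessOp h, EuclideanSpace.basisFun_apply]

lemma continuous_wf_inv : Continuous fun p : E n => (wf p)⁻¹ :=
  (wf_contDiff (m := 0)).continuous.inv₀ fun p => (wf_pos p).ne'

lemma continuous_sqrtG (ξ : E n) : Continuous fun p : E n => sqrtG p ξ := by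
  unfold sqrtG
  have h := continuous_wf_inv (n := n)
  refine continuous_const.sub (Continuous.smul (Continuous.mul ((h.pow 2).div₀
    (continuous_const.add h) fun p => ?_) (continuous_id.inner continuous_const)) continuous_id)
  have := inv_pos.2 (wf_pos p)
  exact (by linarith : (0 : ℝ) < 1 + (wf p)⁻¹).ne'

lemma continuous_trCurv : Continuous fun q : E n × (E n →L[ℝ] E n →L[ℝ] ℝ) => trCurv q.1 q.2 := by
  unfold trCurv
  refine continuous_finsetSum _ fun i _ => (continuous_wf_inv.comp continuous_fst).mul ?_
  have h := (continuous_sqrtG (EuclideanSpace.single i (1 : ℝ))).comp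
    (continuous_fst (X := E n) (Y := E n →L[ℝ] E n →L[ℝ] ℝ))
  exact (continuous_snd.clm_apply h).clm_apply h

lemma continuousOn_trCurv {s : Set (E n)} {g₁ : E n → E n} {g₂ : E n → E n →L[ℝ] E n →L[ℝ] ℝ}
    (h₁ : ContinuousOn g₁ s) (h₂ : ContinuousOn g₂ s) :
    ContinuousOn (fun x => trCurv (g₁ x) (g₂ x)) s := by
  have h : ContinuousOn (fun x => (g₁ x, g₂ x)) s := h₁.prodMk h₂
  exact ContinuousOn.congr (continuous_trCurv.comp_continuousOn h) fun x _ => rfl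

lemma trCurv_le (p : E n) (U : E n →L[ℝ] E n →L[ℝ] ℝ) : trCurv p U ≤ n * ‖U‖ := by
  have hw : (wf p)⁻¹ ≤ 1 := inv_le_one_of_one_le₀ (one_le_wf p)
  have hw0 := inv_pos.2 (wf_pos p)
  have hU := norm_nonneg U
  have h : ∀ i ∈ Finset.univ, (wf p)⁻¹ * U (sqrtG p (EuclideanSpace.single i 1))
      (sqrtG p (EuclideanSpace.single i 1)) ≤ ‖U‖ := fun i _ => by
    have h1 := (le_abs_self _).trans (U.le_opNorm₂ (sqrtG p (EuclideanSpace.single i 1))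
      (sqrtG p (EuclideanSpace.single i 1)))
    have h2 : ‖sqrtG p (EuclideanSpace.single i 1)‖ ≤ 1 := by
      simpa using norm_sqrtG_le p (EuclideanSpace.single i (1 : ℝ))
    have h3 : ‖U‖ * ‖sqrtG p (EuclideanSpace.single i 1)‖ *
        ‖sqrtG p (EuclideanSpace.single i 1)‖ ≤ ‖U‖ := by
      refine (mul_le_of_le_one_right (by positivity) h2).trans ?_
      exact mul_le_of_le_one_right hU h2
    refine (mul_le_mul_of_nonneg_left (h1.trans h3) hw0.le).trans ?_
    exact mul_le_of_le_one_left hU hw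
  have := Finset.sum_le_card_nsmul _ _ _ h
  simpa [trCurv] using this

lemma wf_le (p : E n) : wf p ≤ 1 + ‖p‖ := by
  have := wf_sq p
  nlinarith [norm_nonneg p, wf_pos p]

/-- A linear map diagonal in an orthonormal basis is bounded by its Hilbert–Schmidt norm. -/
lemma norm_apply_le_of_eigenbasis {T : E n →ₗ[ℝ] E n} {b : OrthonormalBasis (Fin n) ℝ (E n)}
    {κ : Fin n → ℝ} (hb : ∀ i, T (b i) = κ i • b i) {R : ℝ} (hR : 0 ≤ R)
    (hκ : ∑ i, κ i ^ 2 ≤ R ^ 2) (ξ : E n) : ‖T ξ‖ ≤ R * ‖ξ‖ := by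
  have h1 : T ξ = ∑ i, (⟪b i, ξ⟫ * κ i) • b i := by
    conv_lhs => rw [← b.sum_repr' ξ]
    simp [map_sum, hb, smul_smul]
  have h2 : ∀ i, ⟪b i, T ξ⟫ = ⟪b i, ξ⟫ * κ i := fun i => by
    rw [h1]; exact b.orthonormal.inner_right_fintype _ i
  refine abs_le_of_sq_le_sq' ?_ (by positivity) |>.2
  rw [← b.sum_sq_inner_right, mul_pow, ← b.sum_sq_inner_right ξ, Finset.mul_sum]
  refine Finset.sum_le_sum fun i _ => ?_
  rw [h2, mul_pow, mul_comm]
  refine mul_le_mul_of_nonneg_right (le_trans ?_ hκ) (sq_nonneg _)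
  exact Finset.single_le_sum (f := fun i => κ i ^ 2) (fun i _ => sq_nonneg _) (Finset.mem_univ i)

/-- The mean curvature of an admissible graph of bounded slope controls the second derivatives. -/
lemma norm_D2_le {k : ℕ} (hk : 2 ≤ k) (hn : 2 ≤ n) {Ω : Set (E n)} {u : E n → ℝ}
    (hadm : IsAdmissible k Ω u) {x : E n} (hx : x ∈ Ω) (h : ContDiffAt ℝ 2 u x) :
    0 < meanCurv u x ∧ ‖D2 u x‖ ≤ wf (gradient u x) ^ 3 * (n * meanCurv u x) := by
  obtain ⟨b, κ, hb⟩ := exists_eigenbasis (p := gradient u x) (hessOp_symm h)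
  obtain ⟨h1, h2, -⟩ := curvatures_of_conj h (L := LinearMap.id) Function.injective_id
    (fun ξ => rfl) hb
  obtain ⟨hH, hK⟩ := (cone_of_admissible hadm hx h1).sum_pos_and_sq_le hk hn
  rw [h2]
  set p := gradient u x with hp
  set H := ∑ i, κ i with hHdef
  have hw := wf_pos p
  have hn1 : (2 : ℝ) ≤ n := by exact_mod_cast hn
  refine ⟨hH, ?_⟩
  have hK2 : ∑ i, κ i ^ 2 ≤ ((n : ℝ) * H) ^ 2 := by
    rw [mul_pow]
    refine hK.trans (mul_le_mul_of_nonneg_right ?_ (sq_nonneg _))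
    nlinarith
  have hsurj : Function.Surjective (sqrtGL p) :=
    LinearMap.injective_iff_surjective.1 (sqrtG_injective p)
  refine ContinuousLinearMap.opNorm_le_bound₂ _ (by positivity) fun ξ ζ => ?_
  obtain ⟨ξ', rfl⟩ := hsurj ξ
  obtain ⟨ζ', rfl⟩ := hsurj ζ
  change ‖D2 u x (sqrtG p ξ') (sqrtG p ζ')‖ ≤ _ * ‖sqrtG p ξ'‖ * ‖sqrtG p ζ'‖
  have e1 : D2 u x (sqrtG p ξ') (sqrtG p ζ') = wf p * ⟪symOp p (hessOp u x) ξ', ζ'⟫ := by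
    rw [inner_symOp, inner_hessOp h]
    field_simp
  rw [e1, norm_mul, Real.norm_of_nonneg hw.le]
  calc wf p * ‖⟪symOp p (hessOp u x) ξ', ζ'⟫‖
      ≤ wf p * ((n * H * (wf p * ‖sqrtG p ξ'‖)) * (wf p * ‖sqrtG p ζ'‖)) := by
        refine mul_le_mul_of_nonneg_left ((norm_inner_le_norm _ _).trans ?_) hw.le
        refine mul_le_mul ?_ (norm_le_sqrtG p ζ') (norm_nonneg _) (by positivity)
        refine (norm_apply_le_of_eigenbasis hb (by positivity) hK2 ξ').trans ?_
        exact mul_le_mul_of_nonneg_left (norm_le_sqrtG p ξ') (by positivity)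
    _ = _ := by ring

lemma le_of_forall_mem_of_continuousOn {Ω : Set (E n)} {f : E n → ℝ}
    (hf : ContinuousOn f (closure Ω)) {R : ℝ} (h : ∀ x ∈ Ω, f x ≤ R) {x : E n}
    (hx : x ∈ closure Ω) : f x ≤ R := by
  have : (𝓝[Ω] x).NeBot := mem_closure_iff_nhdsWithin_neBot.1 hx
  exact le_of_tendsto ((hf x hx).mono_left (nhdsWithin_mono x subset_closure))
    (eventually_mem_nhdsWithin.mono h)

lemma D2bar_eq {Ω : Set (E n)} {u : E n → ℝ} {g : E n → E n →L[ℝ] E n →L[ℝ] ℝ}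
    (hg : ContinuousOn g (closure Ω)) (h : EqOn (D2 u) g Ω) {x : E n} (hx : x ∈ closure Ω) :
    D2bar Ω u x = g x :=
  extendFrom_eq hx (((hg x hx).mono_left (nhdsWithin_mono x subset_closure)).congr'
    (eventually_mem_nhdsWithin.mono fun _ hy => (h hy).symm))

lemma bounds_of_c1Norm_le {Ω : Set (E n)} {u : E n → ℝ} {M : ℝ≥0} (h : c1Norm Ω u ≤ M) {x : E n}
    (hx : x ∈ Ω) : |u x| ≤ M ∧ ‖gradient u x‖ ≤ M := by
  have h1 : ‖u x‖ₑ ≤ M :=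
    (le_iSup₂ (f := fun x _ => ‖u x‖ₑ) x hx).trans ((le_add_right le_rfl).trans h)
  have h2 : ‖gradient u x‖ₑ ≤ M :=
    (le_iSup₂ (f := fun x _ => ‖gradient u x‖ₑ) x hx).trans ((le_add_left le_rfl).trans h)
  exact ⟨enorm_le_coe.1 h1, enorm_le_coe.1 h2⟩

/-- The second derivatives at interior points are bounded in terms of those on the boundary: the
maximum of `H / (W - a)` over the closure is either attained in the interior, where the mean curvature
is bounded by `C₁`, or on the boundary. -/
theorem norm_D2_le_of_boundary {k : ℕ} (hk : 2 ≤ k) (hn : 2 ≤ n) {Ω : Set (E n)} {u : E n → ℝ}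
    (hΩ : IsOpen Ω) (hΩb : Bornology.IsBounded Ω) (hu : IsC2Closure Ω u) {M : ℝ} (hM : 0 ≤ M)
    (huM : ∀ x ∈ Ω, ‖gradient u x‖ ≤ M) (hadm : IsAdmissible k Ω u) {a : ℝ}
    (ha : a = 1 / (2 * (1 + M))) {C₁ : ℝ} (hC₁ : 0 ≤ C₁)
    (hint : ∀ x₀ ∈ Ω, ∀ φ : ℝ, 2 * a ≤ (wf (gradient u x₀))⁻¹ →
      (∀ᶠ x in 𝓝 x₀, meanCurv u x ≤ φ * ((wf (gradient u x))⁻¹ - a)) →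
      meanCurv u x₀ = φ * ((wf (gradient u x₀))⁻¹ - a) → meanCurv u x₀ ≤ C₁)
    {B : ℝ} (hB0 : 0 ≤ B) (hB : ∀ x ∈ frontier Ω, ‖D2bar Ω u x‖ ≤ B) :
    ∀ x ∈ closure Ω, ‖D2bar Ω u x‖ ≤ (1 + M) ^ 3 * (n * ((C₁ + n * B) / a)) := by
  have hu2 : ∀ x ∈ Ω, ContDiffAt ℝ 2 u x := fun x hx => hu.contDiffOn.contDiffAt (hΩ.mem_nhds hx)
  obtain ⟨g₁, hg₁, he₁⟩ := hu.grad_extends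
  obtain ⟨g₂, hg₂, he₂⟩ := hu.hess_extends
  have ha0 : 0 < a := by rw [ha]; positivity
  have hM1 : 0 < 1 + M := by positivity
  have hg₁M : ∀ x ∈ closure Ω, ‖g₁ x‖ ≤ M := fun x hx =>
    le_of_forall_mem_of_continuousOn hg₁.norm (fun y hy => by rw [← he₁ hy]; exact huM y hy) hx
  have hW : ∀ x ∈ closure Ω, 2 * a ≤ (wf (g₁ x))⁻¹ := fun x hx => by
    have h1 : 2 * a = (1 + M)⁻¹ := by rw [ha]; field_simp
    rw [h1]
    exact inv_anti₀ (wf_pos _) ((wf_le _).trans (by linarith [hg₁M x hx]))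
  have hH : ∀ x ∈ Ω, meanCurv u x = trCurv (g₁ x) (g₂ x) := fun x hx => by
    rw [meanCurv_eq_trCurv (hu2 x hx), he₁ hx, he₂ hx]
  have hHc : ContinuousOn (fun x => trCurv (g₁ x) (g₂ x) / ((wf (g₁ x))⁻¹ - a)) (closure Ω) := by
    refine ContinuousOn.div (continuousOn_trCurv hg₁ hg₂)
      ((continuous_wf_inv.comp_continuousOn hg₁).sub continuousOn_const) fun x hx => ?_
    have := hW x hx
    linarith
  intro x hx
  rw [D2bar_eq hg₂ he₂ hx]
  have hg₂n : ContinuousOn (fun x => ‖g₂ x‖) (closure Ω) :=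
    (continuous_norm (E := E n →L[ℝ] E n →L[ℝ] ℝ)).comp_continuousOn hg₂
  refine le_of_forall_mem_of_continuousOn hg₂n (fun y hy => ?_) hx
  rw [← he₂ hy]
  obtain ⟨z, hz, hmax⟩ := hΩb.isCompact_closure.exists_isMaxOn ⟨x, hx⟩ hHc
  have hle : ∀ y ∈ Ω, meanCurv u y ≤
      trCurv (g₁ z) (g₂ z) / ((wf (g₁ z))⁻¹ - a) * ((wf (gradient u y))⁻¹ - a) := fun y hy => by
    have h1 := hmax (subset_closure hy)
    simp only [mem_ofPred_eq] at h1
    have h2 := hW y (subset_closure hy)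
    rw [hH y hy, he₁ hy]
    exact (div_le_iff₀ (by linarith)).1 h1
  have hWz := hW z hz
  have hHz : trCurv (g₁ z) (g₂ z) ≤ C₁ + n * B := by
    by_cases hzΩ : z ∈ Ω
    · rw [← hH z hzΩ]
      have := hint z hzΩ (trCurv (g₁ z) (g₂ z) / ((wf (g₁ z))⁻¹ - a)) (by rwa [he₁ hzΩ])
        (by filter_upwards [hΩ.mem_nhds hzΩ] with y hy using hle y hy)
        (by rw [hH z hzΩ, he₁ hzΩ, div_mul_cancel₀]; linarith)
      have h3 : 0 ≤ n * B := by positivity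
      linarith
    · have h1 := hB z ⟨hz, by rwa [hΩ.interior_eq]⟩
      rw [D2bar_eq hg₂ he₂ hz] at h1
      have h2 := mul_le_mul_of_nonneg_left h1 (Nat.cast_nonneg (α := ℝ) n)
      linarith [trCurv_le (g₁ z) (g₂ z)]
  obtain ⟨hHy, hD⟩ := norm_D2_le hk hn hadm hy (hu2 y hy)
  have hφ : trCurv (g₁ z) (g₂ z) / ((wf (g₁ z))⁻¹ - a) ≤ (C₁ + n * B) / a :=
    div_le_div₀ (by positivity) hHz ha0 (by linarith)
  have hHy2 : meanCurv u y ≤ (C₁ + n * B) / a := by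
    refine (hle y hy).trans ?_
    have h1 : (wf (gradient u y))⁻¹ - a ≤ 1 := by
      have := inv_le_one_of_one_le₀ (one_le_wf (gradient u y))
      linarith
    have h2 : 0 ≤ (wf (gradient u y))⁻¹ - a := by
      have := hW y (subset_closure hy)
      rw [← he₁ hy] at this
      linarith
    refine (mul_le_mul_of_nonneg_right hφ h2).trans (mul_le_of_le_one_right (by positivity) h1)
  refine hD.trans (mul_le_mul (pow_le_pow_left₀ (wf_pos _).le ((wf_le _).trans ?_) 3)
    (mul_le_mul_of_nonneg_left hHy2 (Nat.cast_nonneg n)) (by positivity) (by positivity))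
  linarith [huM y hy]

end GraphCurv

end

theorem theorem4p1 (n k l : ℕ) (hk : 2 ≤ k) (hlk : l < k) (hkn : k < n) (M N : ℝ≥0) :
    ∃ C : ℝ≥0, 0 < C ∧
      ∀ (Ω : Set (GraphCurv.E n)) (ψ : GraphCurv.E n × ℝ × GraphCurv.V n → ℝ)
        (u : GraphCurv.E n → ℝ),
        IsOpen Ω → IsConnected Ω → Bornology.IsBounded Ω →
        (∀ q ∈ closure Ω ×ˢ (univ : Set ℝ) ×ˢ Metric.sphere (0 : GraphCurv.V n) 1, 0 ≤ ψ q) →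
        GraphCurv.IsC11 Ω (fun q => ψ q ^ (1 / ((k : ℝ) - (l : ℝ)))) →
        GraphCurv.c11Norm Ω (M : ℝ) (fun q => ψ q ^ (1 / ((k : ℝ) - (l : ℝ)))) ≤ (N : ℝ≥0∞) →
        ContDiffOn ℝ 4 u Ω → GraphCurv.IsC2Closure Ω u →
        GraphCurv.c1Norm Ω u ≤ (M : ℝ≥0∞) →
        GraphCurv.IsAdmissible k Ω u →
        GraphCurv.SolvesDirichlet k l Ω ψ u →
        (⨆ x ∈ closure Ω, ‖GraphCurv.D2bar Ω u x‖ₑ) ≤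
          (C : ℝ≥0∞) * (1 + ⨆ x ∈ frontier Ω, ‖GraphCurv.D2bar Ω u x‖ₑ) := by
  obtain ⟨c, hc, hsup⟩ := GraphCurv.exists_supergradient n k l hlk hkn
  have hn : 2 ≤ n := by omega
  obtain ⟨a, ha⟩ : ∃ a : ℝ, a = 1 / (2 * (1 + M)) := ⟨_, rfl⟩
  have ha0 : 0 < a := by rw [ha]; positivity
  obtain ⟨C₁, hC₁⟩ : ∃ C₁ : ℝ, C₁ = 1 + n / (a * c) *
    (N * (1 + n ^ 2 / a + n ^ 2 + n * (1 + n) ^ 2 + n * (1 + n) / a)) := ⟨_, rfl⟩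
  have hC₁0 : 0 < C₁ := by rw [hC₁]; positivity
  have hn0 : (0 : ℝ) < n := by exact_mod_cast (by omega : 0 < n)
  have hC0 : 0 < (1 + (M : ℝ)) ^ 3 * (n * ((C₁ + n) / a)) := by positivity
  obtain ⟨C, hC⟩ : ∃ C : ℝ≥0, (C : ℝ) = (1 + (M : ℝ)) ^ 3 * (n * ((C₁ + n) / a)) :=
    ⟨⟨_, hC0.le⟩, rfl⟩
  rw [← hC, NNReal.coe_pos] at hC0
  have hCB : ∀ B : ℝ≥0, ((C * (1 + B) : ℝ≥0) : ℝ) =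
      (1 + (M : ℝ)) ^ 3 * (n * ((C₁ + n) / a)) * (1 + B) := fun B => by
    rw [NNReal.coe_mul, NNReal.coe_add, NNReal.coe_one, hC]
  refine ⟨C, hC0, fun Ω ψ u hΩ _ hΩb _ hψ hψN hu4 hu2 huM hadm hsol => ?_⟩
  generalize hB : (⨆ x ∈ frontier Ω, ‖GraphCurv.D2bar Ω u x‖ₑ) = B
  induction B with
  | top =>
    rw [add_top, ENNReal.mul_top]
    · exact le_top
    · exact ENNReal.coe_ne_zero.2 hC0.ne'
  | coe B =>
    have key := GraphCurv.norm_D2_le_of_boundary hk hn hΩ hΩb hu2 M.coe_nonneg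
      (fun x hx => (GraphCurv.bounds_of_c1Norm_le huM hx).2) hadm ha hC₁0.le
      (fun x₀ hx₀ φ h1 h2 h3 => hC₁ ▸ GraphCurv.meanCurv_le_of_touching hk hlk hkn hc hsup hΩ hψ hψN
        hu4 (fun x hx => (GraphCurv.bounds_of_c1Norm_le huM hx).1) hadm hsol hx₀ ha0 h1 h2 h3)
      B.coe_nonneg (fun x hx => by
        have : ‖GraphCurv.D2bar Ω u x‖ₑ ≤ B :=
          hB ▸ le_iSup₂ (f := fun x _ => ‖GraphCurv.D2bar Ω u x‖ₑ) x hx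
        exact enorm_le_coe.1 this)
    refine iSup₂_le fun x hx => ?_
    rw [← ENNReal.coe_one, ← ENNReal.coe_add, ← ENNReal.coe_mul]
    refine enorm_le_coe.2 ((key x hx).trans (le_of_le_of_eq ?_ (hCB B).symm))
    have h4 : (C₁ + n * B) ≤ (C₁ + n) * (1 + B) := by nlinarith [B.coe_nonneg, mul_nonneg hC₁0.le B.coe_nonneg]
    calc _ ≤ (1 + (M : ℝ)) ^ 3 * (n * ((C₁ + n) * (1 + B) / a)) := by
          gcongr
      _ = _ := by ring
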